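/- Lattice simplices are taken with respect to the integer lattice: $\mathbb{Z}^d$ for simplices in $\mathbb{R}^d$, and more generally $\mathbb{Z}^n\cap\operatorname{aff}(\Delta)$ for a simplex $\Delta\subset\mathbb{R}^n$. A lattice $d$-simplex is the convex hull of $d+1$ affinely independent lattice points. It is *empty* if its vertices are its only lattice points. Its *lattice width* is the minimum length of the interval $f(\Delta)$ over all affine functionals $f$ on $\operatorname{aff}(\Delta)$ that are non-constant and whose linear part takes integer values on the integer vectors parallel to $\operatorname{aff}(\Delta)$. Let $w_e(d)$ be the maximum (a priori, the supremum in $[0,\infty]$) of the lattice widths of empty $d$-simplices in $\mathbb{R}^d$. For $d\ge 2$ and an integer $m\ge 1$ let $S(d,m)\subset\mathbb{R}^{d+1}$ be the convex hull of the $d+1$ cyclic shifts of the vector $(1,m,0,\dots,0,-m)\in\mathbb{R}^{d+1}$ (with $d-2$ zeros). **Theorem 1.3.** For every even $d\ge 2$ the equation $$m^{d-1}=\sum_{i=0}^{d/2-1}\binom{d-1-i}{i}m^{2i}$$ has a unique positive real solution $m_0(d)$. For every even $d\ge 2$, $S(d,\lfloor m_0(d)\rfloor)$ is a lattice $d$-simplex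 of lattice width $2\lfloor m_0(d)\rfloor$, and for every even $d\ge 4$ it is empty. Moreover, $\lim_{d\to\infty} w_e(d)/d$ exists in $[0,\infty]$, and $$\lim_{d\to\infty}\frac{w_e(d)}{d}\;\ge\;\lim_{\substack{d\to\infty\\ d\text{ even}}}\frac{2m_0(d)}{d}=\frac{1}{\operatorname{arcsinh}(1)}=\frac{1}{\ln(1+\sqrt2)}\approx 1.1346,$$ where $\approx$ means that the difference is less than $0.00005$ in absolute value. -/

import Mathlib

open Filter Topology

noncomputable section

/-- The points of the lattice `ℤ^ι` in `ℝ^ι`. -/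
def IsLatticePoint {ι : Type*} (x : ι → ℝ) : Prop :=
  ∀ i, ∃ n : ℤ, x i = n

/-- The non-zero lattice functionals on the affine hull of `K`, with respect to the lattice
`ℤ^ι ∩ aff K`, up to additive constants: `f` takes integer values on all lattice vectors that are
parallel to `aff K`, and `f` is not constant on `aff K`. If `K` affinely spans `ℝ^ι`, this says
that `f` lies in the dual lattice of `ℤ^ι` and is not zero. -/
def IsLatticeFunctional {ι : Type*} (K : Set (ι → ℝ)) (f : (ι → ℝ) →ₗ[ℝ] ℝ) : Prop :=
  (∀ x ∈ vectorSpan ℝ K, IsLatticePoint x → ∃ n : ℤ, f x = n) ∧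
    ∃ x ∈ vectorSpan ℝ K, f x ≠ 0

/-- The lattice width of `K`, relative to the lattice `ℤ^ι ∩ aff K`: the least length of `f(K)`
over all non-zero lattice functionals `f`. The length of the interval `f(K)` is its diameter. -/
def latticeWidth {ι : Type*} (K : Set (ι → ℝ)) : ENNReal :=
  ⨅ (f : (ι → ℝ) →ₗ[ℝ] ℝ) (_ : IsLatticeFunctional K f), Metric.ediam (f '' K)

/-- The points `p 0, …, p d` are the vertices of a lattice `d`-simplex. -/
structure IsLatticeSimplex {ι : Type*} {d : ℕ} (p : Fin (d + 1) → ι → ℝ) : Prop where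
  affineIndependent : AffineIndependent ℝ p
  isLatticePoint : ∀ i, IsLatticePoint (p i)

/-- The lattice simplex with vertices `p 0, …, p d` is empty: its vertices are the only lattice
points in it. -/
structure IsEmptyLatticeSimplex {ι : Type*} {d : ℕ} (p : Fin (d + 1) → ι → ℝ) : Prop
    extends IsLatticeSimplex p where
  eq_vertex : ∀ x ∈ convexHull ℝ (Set.range p), IsLatticePoint x → ∃ i, x = p i

/-- `w_e(d)`: the largest lattice width of an empty `d`-simplex in `ℝ^d` with the lattice `ℤ^d`,
as a supremum in `[0, ∞]`. -/
def maxEmptyWidth (d : ℕ) : ENNReal :=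
  ⨆ (p : Fin (d + 1) → Fin d → ℝ) (_ : IsEmptyLatticeSimplex p),
    latticeWidth (convexHull ℝ (Set.range p))

/-- The vector `(1, m, 0, …, 0, -m)` of length `d + 1`. -/
def circulantGenerator (d : ℕ) (m : ℝ) : Fin (d + 1) → ℝ :=
  Pi.single 0 1 + Pi.single 1 m - Pi.single (Fin.last d) m

/-- The vertex `v^(i)` of `S(d, m)`: the `i`-th cyclic shift to the right of
`(1, m, 0, …, 0, -m)`. Subtraction in `Fin (d + 1)` is modulo `d + 1`. -/
def circulantVertex (d : ℕ) (m : ℝ) (i : Fin (d + 1)) : Fin (d + 1) → ℝ :=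
  fun j => circulantGenerator d m (j - i)

/-- The circulant simplex `S(d, m)`. -/
def circulantSimplex (d : ℕ) (m : ℝ) : Set (Fin (d + 1) → ℝ) :=
  convexHull ℝ (Set.range (circulantVertex d m))

/-- `m` is a positive solution of the equation
`m^(d-1) = ∑_{i=0}^{d/2-1} binom(d-1-i, i) m^(2i)` (for even `d ≥ 2`). -/
def IsThreshold (d : ℕ) (m : ℝ) : Prop :=
  0 < m ∧ m ^ (d - 1) =
    ∑ i ∈ Finset.range (d / 2), (Nat.choose (d - 1 - i) i : ℝ) * m ^ (2 * i)

/-- `m₀(d)`: the positive solution of the equation above, which is unique for even `d ≥ 2`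
(arbitrary otherwise). -/
def threshold (d : ℕ) : ℝ :=
  Classical.epsilon (IsThreshold d)

end

/-! Let `F_n(x)` be the Fibonacci polynomials `fibPoly x n`. Dividing the equation by `m^(d-1)`
turns it into `F_d(1/m) = 1`. Monotonicity of `F_d` gives uniqueness. With `1/m = 2 sinh t`, the
equation for even `d` reads `sinh (d t) = cosh t`; hence `t → 0`, `d t → arsinh 1` and `2 m₀(d) / d
→ 1 / arsinh 1`.

Width of `S(d, m)`: a functional is an integer function `F` on a cycle of odd length, and its value
at vertex `i` is `F i + m (F (i+1) - F (i-1))` up to a constant. Some ascent `i` and some descent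
`j` satisfy `F j ≤ F i` (`exists_increase_decrease`), so these values differ by at least `2m`. A
coordinate attains `2m`.

Emptiness: let `w` be the barycentric coordinates of a lattice point and `τ` the fractional parts of
`m w`. At all but one place of the cycle, `w j = τ (j+1) - τ (j-1)`, while `w j ≥ τ j / m`. Thus `τ`
grows like a Fibonacci sequence, at least by the factor `F_d(1/m)` in one turn. If this exceeds 1,
then `τ = 0` and the point is a vertex. For `m = ⌊m₀(d)⌋` it does exceed 1, because `m₀(d)` is not
an integer when `d ≥ 4`.

Limit: an empty `d`-simplex of width above `W` yields empty `D`-simplices of width at least `(D/d -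
4) W` for all `D ≥ 4d` (`cyclicBlocks`). Hence `w_e(d)/d` is at most the lower limit of the whole
sequence, for every `d ≥ 1`, and the sequence converges in `[0, ∞]`. Its even subsequence gives the
bound. -/

/-! ### Fibonacci polynomials and the threshold -/

/-- The Fibonacci polynomials, evaluated at a real number. -/
def fibPoly (x : ℝ) : ℕ → ℝ
  | 0 => 0
  | 1 => 1
  | n + 2 => x * fibPoly x (n + 1) + fibPoly x n

theorem fibPoly_zero (x : ℝ) : fibPoly x 0 = 0 := rfl

theorem fibPoly_one (x : ℝ) : fibPoly x 1 = 1 := rfl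

theorem fibPoly_add_two (x : ℝ) (n : ℕ) :
    fibPoly x (n + 2) = x * fibPoly x (n + 1) + fibPoly x n := rfl

theorem fibPoly_nonneg {x : ℝ} (hx : 0 ≤ x) (n : ℕ) : 0 ≤ fibPoly x n := by
  induction n using Nat.twoStepInduction with
  | zero => simp [fibPoly_zero]
  | one => simp [fibPoly_one]
  | more n h1 h2 => rw [fibPoly_add_two]; positivity

theorem fibPoly_pos {x : ℝ} (hx : 0 < x) (n : ℕ) : 0 < fibPoly x (n + 1) := by
  induction n with
  | zero => simp [fibPoly_one]
  | succ n ih =>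
    rw [fibPoly_add_two]
    have := fibPoly_nonneg hx.le n
    positivity

theorem fibPoly_mono {x y : ℝ} (hx : 0 ≤ x) (hxy : x ≤ y) (n : ℕ) :
    fibPoly x n ≤ fibPoly y n := by
  induction n using Nat.twoStepInduction with
  | zero => simp [fibPoly_zero]
  | one => simp [fibPoly_one]
  | more n h1 h2 =>
    rw [fibPoly_add_two, fibPoly_add_two]
    have := fibPoly_nonneg hx (n + 1)
    gcongr
    linarith

theorem fibPoly_strictMono {x y : ℝ} (hx : 0 ≤ x) (hxy : x < y) (n : ℕ) :
    fibPoly x (n + 2) < fibPoly y (n + 2) := by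
  rw [fibPoly_add_two, fibPoly_add_two]
  have h1 := fibPoly_mono hx hxy.le n
  have h2 := fibPoly_mono hx hxy.le (n + 1)
  have h3 := fibPoly_pos (hx.trans_lt hxy) n
  nlinarith

theorem continuous_fibPoly (n : ℕ) : Continuous fun x => fibPoly x n := by
  induction n using Nat.twoStepInduction with
  | zero => simp only [fibPoly_zero]; fun_prop
  | one => simp only [fibPoly_one]; fun_prop
  | more n h1 h2 => simp only [fibPoly_add_two]; fun_prop

theorem fibPoly_zero_even (k : ℕ) : fibPoly 0 (2 * k) = 0 := by
  induction k with
  | zero => rfl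
  | succ k ih => rw [mul_add, mul_one, fibPoly_add_two, ih]; simp

theorem one_le_fibPoly_one (n : ℕ) : 1 ≤ fibPoly 1 (n + 1) := by
  induction n with
  | zero => simp [fibPoly_one]
  | succ n ih =>
    rw [fibPoly_add_two]
    have := fibPoly_nonneg zero_le_one n
    linarith

theorem sum_choose_antidiagonal_add_two (y : ℝ) (n : ℕ) :
    ∑ p ∈ Finset.HasAntidiagonal.antidiagonal (n + 2), (p.1.choose p.2 : ℝ) * y ^ p.2 =
      ∑ p ∈ Finset.HasAntidiagonal.antidiagonal (n + 1), (p.1.choose p.2 : ℝ) * y ^ p.2 +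
        y * ∑ p ∈ Finset.HasAntidiagonal.antidiagonal n, (p.1.choose p.2 : ℝ) * y ^ p.2 := by
  rw [Finset.Nat.antidiagonal_succ_succ', Finset.Nat.antidiagonal_succ']
  simp only [Finset.sum_cons, Finset.sum_map, Function.Embedding.prodMap,
    Function.Embedding.coeFn_mk, Function.Embedding.refl_apply, Prod.map,
    Nat.succ_eq_add_one, Nat.choose_succ_succ, Nat.cast_add, add_mul, Finset.sum_add_distrib,
    pow_succ, Finset.mul_sum]
  simp [mul_comm, mul_assoc, add_comm, add_left_comm]

/-- Diagonal sums of Pascal's triangle: Pascal's rule, weighted by powers of `m ^ 2`, is the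
Fibonacci recurrence. -/
theorem pow_mul_fibPoly_inv {m : ℝ} (hm : m ≠ 0) (n : ℕ) :
    m ^ n * fibPoly m⁻¹ (n + 1) =
      ∑ p ∈ Finset.HasAntidiagonal.antidiagonal n, (p.1.choose p.2 : ℝ) * (m ^ 2) ^ p.2 := by
  induction n using Nat.twoStepInduction with
  | zero => simp [fibPoly_one]
  | one => simp [fibPoly, Finset.Nat.antidiagonal_succ, hm]
  | more n h1 h2 =>
    rw [sum_choose_antidiagonal_add_two, ← h1, ← h2, fibPoly_add_two]
    field_simp
    ring

theorem pow_mul_fibPoly_inv_even {m : ℝ} (hm : m ≠ 0) {k : ℕ} (hk : 1 ≤ k) :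
    m ^ (2 * k - 1) * fibPoly m⁻¹ (2 * k) =
      ∑ i ∈ Finset.range (2 * k / 2),
        (Nat.choose (2 * k - 1 - i) i : ℝ) * m ^ (2 * i) := by
  obtain ⟨n, hn⟩ : ∃ n, 2 * k = n + 1 := ⟨2 * k - 1, by omega⟩
  have h := pow_mul_fibPoly_inv hm n
  rw [Finset.Nat.sum_antidiagonal_eq_sum_range_succ_mk, ← Finset.sum_range_reflect] at h
  rw [show 2 * k - 1 = n by omega, hn, h]
  symm
  refine (Finset.sum_congr rfl fun i hi => ?_).trans
    (Finset.sum_subset (s₁ := Finset.range ((n + 1) / 2)) (fun i hi => ?_) fun i hi hi' => ?_)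
  · rw [Finset.mem_range] at hi
    simp only [Nat.succ_eq_add_one]
    rw [show n + 1 - 1 - i = n - i by omega, show n - (n - i) = i by omega, pow_mul]
  · rw [Finset.mem_range] at *; omega
  · rw [Finset.mem_range] at *
    rw [Nat.choose_eq_zero_of_lt (by omega)]; simp

theorem isThreshold_even_iff {k : ℕ} (hk : 1 ≤ k) (m : ℝ) :
    IsThreshold (2 * k) m ↔ 0 < m ∧ fibPoly m⁻¹ (2 * k) = 1 := by
  refine and_congr_right fun hm => ?_
  rw [← pow_mul_fibPoly_inv_even hm.ne' hk]
  have : m ^ (2 * k - 1) ≠ 0 := by positivity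
  rw [eq_comm, mul_eq_left₀ this]

theorem existsUnique_isThreshold {d : ℕ} (hd : Even d) (hd2 : 2 ≤ d) :
    ∃! m : ℝ, IsThreshold d m := by
  obtain ⟨k, rfl⟩ := hd.two_dvd
  have hk : 1 ≤ k := by omega
  obtain ⟨n, hn⟩ : ∃ n, 2 * k = n + 2 := ⟨2 * k - 2, by omega⟩
  have h1 : 1 ≤ fibPoly 1 (2 * k) := by rw [hn]; exact one_le_fibPoly_one _
  have h0 : fibPoly 0 (2 * k) ≤ 1 := by rw [fibPoly_zero_even]; exact zero_le_one
  obtain ⟨x, ⟨hx0, -⟩, hx⟩ := intermediate_value_Icc zero_le_one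
    (continuous_fibPoly (2 * k)).continuousOn ⟨h0, h1⟩
  simp only [isThreshold_even_iff hk]
  have hx0' : 0 < x := by
    refine hx0.lt_of_ne fun h => ?_
    subst h
    exact zero_ne_one ((fibPoly_zero_even k).symm.trans hx)
  refine ⟨x⁻¹, ⟨by positivity, by rwa [inv_inv]⟩, ?_⟩
  rintro m ⟨hm, hfm⟩
  have hm' : 0 < m⁻¹ := by positivity
  rw [← inv_inj, inv_inv]
  by_contra hne
  rw [hn] at hx hfm
  rcases lt_or_gt_of_ne hne with h | h
  · exact (fibPoly_strictMono hm'.le h n).ne (hfm.trans hx.symm)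
  · exact (fibPoly_strictMono hx0 h n).ne (hx.trans hfm.symm)

theorem threshold_spec {k : ℕ} (hk : 1 ≤ k) :
    0 < threshold (2 * k) ∧ fibPoly (threshold (2 * k))⁻¹ (2 * k) = 1 :=
  (isThreshold_even_iff hk _).1 (Classical.epsilon_spec
    (existsUnique_isThreshold (even_two_mul k) (by omega)).exists)

theorem one_le_threshold {k : ℕ} (hk : 1 ≤ k) : 1 ≤ threshold (2 * k) := by
  obtain ⟨hm, hf⟩ := threshold_spec hk
  by_contra! h
  have h1 : 1 < (threshold (2 * k))⁻¹ := (one_lt_inv₀ hm).2 h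
  obtain ⟨n, hn⟩ : ∃ n, 2 * k = n + 2 := ⟨2 * k - 2, by omega⟩
  have h2 := fibPoly_strictMono zero_le_one h1 n
  rw [← hn, hf, hn] at h2
  exact (one_le_fibPoly_one (n + 1)).not_gt h2

/-- Modulo an integer root `a`, only the constant term 1 of the equation survives, so `a = 1`; but
at 1 the right-hand side exceeds 1. For `d = 2` the root is 1, which is why emptiness starts at `d =
4`. -/
theorem threshold_ne_natCast {k : ℕ} (hk : 2 ≤ k) (a : ℕ) : threshold (2 * k) ≠ a := by
  intro h
  obtain ⟨-, he⟩ : IsThreshold (2 * k) (threshold (2 * k)) := Classical.epsilon_spec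
    (existsUnique_isThreshold (even_two_mul k) (by omega)).exists
  have h1 := one_le_threshold (k := k) (by omega)
  obtain ⟨n, rfl⟩ : ∃ n, k = n + 2 := ⟨k - 2, by omega⟩
  rw [h] at he h1
  have he' : a ^ (2 * (n + 2) - 1) = ∑ i ∈ Finset.range (2 * (n + 2) / 2),
      Nat.choose (2 * (n + 2) - 1 - i) i * a ^ (2 * i) := by exact_mod_cast he
  rw [show 2 * (n + 2) / 2 = n + 1 + 1 by omega, Finset.sum_range_succ',
    show 2 * (n + 2) - 1 = 2 * n + 3 by omega] at he'
  have hdvd : a ∣ 1 := by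
    have h2 : a ∣ a ^ (2 * n + 3) := dvd_pow_self _ (by omega)
    have h3 : a ∣ ∑ i ∈ Finset.range (n + 1),
        Nat.choose (2 * n + 3 - (i + 1)) (i + 1) * a ^ (2 * (i + 1)) :=
      Finset.dvd_sum fun i _ => (dvd_pow_self _ (by omega)).mul_left _
    rw [he'] at h2
    simpa using (Nat.dvd_add_right h3).1 h2
  obtain rfl : a = 1 := Nat.dvd_one.1 hdvd
  rw [Finset.sum_range_succ'] at he'
  simp at he'

theorem one_lt_fibPoly_floor_threshold {k : ℕ} (hk : 2 ≤ k) :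
    1 < fibPoly (⌊threshold (2 * k)⌋₊ : ℝ)⁻¹ (2 * k) := by
  obtain ⟨hm, hf⟩ := threshold_spec (k := k) (by omega)
  have h1 := one_le_threshold (k := k) (by omega)
  have hpos : 0 < ⌊threshold (2 * k)⌋₊ := Nat.floor_pos.2 h1
  have hlt : (⌊threshold (2 * k)⌋₊ : ℝ) < threshold (2 * k) :=
    (Nat.floor_le hm.le).lt_of_ne (threshold_ne_natCast hk _).symm
  have hinv : (threshold (2 * k))⁻¹ < (⌊threshold (2 * k)⌋₊ : ℝ)⁻¹ :=
    inv_strictAnti₀ (by exact_mod_cast hpos) hlt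
  obtain ⟨n, hn⟩ : ∃ n, 2 * k = n + 2 := ⟨2 * k - 2, by omega⟩
  have := fibPoly_strictMono (by positivity) hinv n
  rwa [← hn, hf] at this

/-! ### Asymptotics of the threshold -/

/-- Binet's formula: for `x = 2 sinh t` the roots of `λ² = x λ + 1` are `exp t` and `-exp (-t)`. -/
theorem fibPoly_two_mul_sinh (t : ℝ) (k : ℕ) :
    fibPoly (2 * Real.sinh t) (2 * k) * Real.cosh t = Real.sinh (2 * k * t) ∧
      fibPoly (2 * Real.sinh t) (2 * k + 1) * Real.cosh t = Real.cosh ((2 * k + 1) * t) := by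
  induction k with
  | zero => simp [fibPoly]
  | succ k ih =>
    obtain ⟨h1, h2⟩ := ih
    have h3 : fibPoly (2 * Real.sinh t) (2 * (k + 1)) * Real.cosh t =
        Real.sinh (2 * ((k + 1 : ℕ) : ℝ) * t) := by
      rw [mul_add, mul_one, fibPoly_add_two, add_mul, mul_assoc, h2, h1]
      push_cast
      rw [show 2 * ((k : ℝ) + 1) * t = (2 * k + 1) * t + t by ring,
        show 2 * (k : ℝ) * t = (2 * k + 1) * t - t by ring, Real.sinh_add, Real.sinh_sub]
      ring
    refine ⟨h3, ?_⟩
    rw [show 2 * (k + 1) + 1 = (2 * k + 1) + 2 by ring, fibPoly_add_two, add_mul, mul_assoc, h2,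
      show 2 * k + 1 + 1 = 2 * (k + 1) by ring, h3]
    push_cast
    rw [show (2 * ((k : ℝ) + 1) + 1) * t = (2 * (k + 1)) * t + t by ring,
        show (2 * (k : ℝ) + 1) * t = (2 * (k + 1)) * t - t by ring, Real.cosh_add, Real.cosh_sub]
    ring

theorem tendsto_two_mul_threshold_div :
    Tendsto (fun k : ℕ => 2 * threshold (2 * k) / ((2 * k : ℕ) : ℝ)) atTop
      (𝓝 (1 / Real.arsinh 1)) := by
  set t : ℕ → ℝ := fun k => Real.arsinh ((threshold (2 * k))⁻¹ / 2) with ht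
  have hsinh : ∀ k, 2 * Real.sinh (t k) = (threshold (2 * k))⁻¹ := fun k => by
    rw [ht]; simp only [Real.sinh_arsinh]; ring
  have hpos : ∀ k, 1 ≤ k → 0 < t k := fun k hk => by
    have := (threshold_spec hk).1
    rw [ht]; simp only [Real.arsinh_pos_iff]; positivity
  have hkey : ∀ k : ℕ, 1 ≤ k → 2 * (k : ℝ) * t k = Real.arsinh (Real.cosh (t k)) := fun k hk => by
    have h := (fibPoly_two_mul_sinh (t k) k).1
    rw [hsinh, (threshold_spec hk).2, one_mul] at h
    rw [h, Real.arsinh_sinh]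
  have hbound : ∀ k, 1 ≤ k → t k ≤ Real.arsinh 2 / k := fun k hk => by
    have hk' : (0 : ℝ) < k := by exact_mod_cast hk
    have h1 : t k ≤ Real.arsinh (Real.cosh (t k)) / k := by
      rw [← hkey k hk, le_div_iff₀ hk']
      have := (mul_pos hk' (hpos k hk)).le
      linarith
    refine h1.trans ?_
    gcongr
    rw [ht]
    simp only [Real.cosh_arsinh]
    have h2 : (threshold (2 * k))⁻¹ ≤ 1 := inv_le_one_of_one_le₀ (one_le_threshold hk)
    have h3 : 0 < (threshold (2 * k))⁻¹ := inv_pos.2 (threshold_spec hk).1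
    rw [Real.sqrt_le_left (by norm_num)]
    nlinarith
  have ht0 : Tendsto t atTop (𝓝 0) := by
    refine tendsto_of_tendsto_of_tendsto_of_le_of_le' tendsto_const_nhds
      (tendsto_const_div_atTop_nhds_zero_nat (Real.arsinh 2)) ?_ ?_
    · filter_upwards [eventually_ge_atTop 1] with k hk using (hpos k hk).le
    · filter_upwards [eventually_ge_atTop 1] with k hk using hbound k hk
  have hlim1 : Tendsto (fun k => Real.arsinh (Real.cosh (t k))) atTop (𝓝 (Real.arsinh 1)) := by
    have : Continuous fun x => Real.arsinh (Real.cosh x) :=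
      Real.continuous_arsinh.comp Real.continuous_cosh
    have h := (this.tendsto 0).comp ht0
    rwa [Real.cosh_zero] at h
  have hlim2 : Tendsto (fun k => Real.sinh (t k) / t k) atTop (𝓝 1) := by
    have h := (Real.hasDerivAt_sinh 0).tendsto_slope
    rw [Real.cosh_zero] at h
    have h2 : Tendsto t atTop (𝓝[≠] 0) := tendsto_nhdsWithin_iff.2 ⟨ht0, by
      filter_upwards [eventually_ge_atTop 1] with k hk using (hpos k hk).ne'⟩
    refine (h.comp h2).congr fun k => ?_
    simp [slope_def_field]
  -- Since `m₀ = 1 / (2 sinh t)`, the quotient `2 m₀ / (2k)` is the inverse of `(2k t) * (sinh t /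
  -- t)`.
  have h := (hlim1.mul hlim2).inv₀ (by simp)
  rw [mul_one, ← one_div] at h
  refine h.congr' ?_
  filter_upwards [eventually_ge_atTop 1] with k hk
  have h1 := (hpos k hk).ne'
  have h2 := (threshold_spec hk).1.ne'
  have hk' : (k : ℝ) ≠ 0 := by positivity
  have h3 : Real.sinh (t k) = (threshold (2 * k))⁻¹ / 2 := by rw [← hsinh]; ring
  rw [← hkey k hk, h3]
  push_cast
  field_simp

theorem arsinh_one : Real.arsinh 1 = Real.log (1 + √2) := by
  rw [Real.arsinh]; norm_num

theorem abs_one_div_arsinh_one_sub_lt : |1 / Real.arsinh 1 - 1.1346| < 0.00005 := by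
  have hs1 : (1.41421 : ℝ) < √2 := Real.lt_sqrt_of_sq_lt (by norm_num)
  have hs2 : √2 < (1.41422 : ℝ) := (Real.sqrt_lt' (by norm_num)).2 (by norm_num)
  have h1 : (0.88134 : ℝ) < Real.arsinh 1 := by
    rw [arsinh_one, Real.lt_log_iff_exp_lt (by positivity)]
    refine (Real.exp_bound' (n := 9) (by norm_num) (by norm_num) (by norm_num)).trans_lt
      (lt_trans ?_ (add_lt_add_right hs1 1))
    norm_num [Finset.sum_range_succ, Nat.factorial]
  have h2 : Real.arsinh 1 < (0.8814 : ℝ) := by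
    rw [arsinh_one, Real.log_lt_iff_lt_exp (by positivity)]
    refine lt_of_lt_of_le ((add_lt_add_right hs2 1).trans ?_)
      (Real.sum_le_exp_of_nonneg (by norm_num) 9)
    norm_num [Finset.sum_range_succ, Nat.factorial]
  rw [abs_lt]
  have h0 : 0 < Real.arsinh 1 := by linarith
  constructor
  · rw [lt_sub_iff_add_lt, lt_div_iff₀ h0]; linarith
  · rw [sub_lt_iff_lt_add, div_lt_iff₀ h0]; linarith

/-! ### Convex hulls and lattice width -/

theorem mem_convexHull_range {ι V : Type*} [Fintype ι] [AddCommGroup V] [Module ℝ V]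
    (p : ι → V) (x : V) :
    x ∈ convexHull ℝ (Set.range p) ↔
      ∃ w : ι → ℝ, (∀ i, 0 ≤ w i) ∧ ∑ i, w i = 1 ∧ ∑ i, w i • p i = x := by
  constructor
  · intro hx
    rw [convexHull_range_eq_exists_affineCombination] at hx
    obtain ⟨s, w, hw0, hw1, rfl⟩ := hx
    classical
    refine ⟨fun i => if i ∈ s then w i else 0, fun i => ?_, by simpa using hw1, ?_⟩
    · dsimp only; split_ifs with h
      exacts [hw0 i h, le_rfl]
    · rw [Finset.affineCombination_eq_linear_combination _ _ _ hw1]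
      simp [ite_smul]
  · rintro ⟨w, hw0, hw1, rfl⟩
    exact (convex_convexHull ℝ _).sum_mem (fun i _ => hw0 i) hw1
      fun i _ => subset_convexHull ℝ _ ⟨i, rfl⟩

section LatticeWidth

variable {ι κ : Type*}

theorem latticeWidth_le_image (T : (ι → ℝ) →ₗ[ℝ] (κ → ℝ))
    (hT : ∀ x, IsLatticePoint x → IsLatticePoint (T x)) (K : Set (ι → ℝ)) :
    latticeWidth K ≤ latticeWidth (T '' K) := by
  refine le_iInf₂ fun f hf => ?_
  have hspan : vectorSpan ℝ (T '' K) = (vectorSpan ℝ K).map T :=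
    (AffineMap.map_vectorSpan T.toAffineMap).symm
  have hfT : IsLatticeFunctional K (f ∘ₗ T) := by
    refine ⟨fun x hx hxl => hf.1 (T x) (hspan ▸ Submodule.mem_map_of_mem hx) (hT x hxl), ?_⟩
    obtain ⟨y, hy, hy0⟩ := hf.2
    rw [hspan] at hy
    obtain ⟨x, hx, rfl⟩ := hy
    exact ⟨x, hx, hy0⟩
  refine (iInf₂_le (f ∘ₗ T) hfT).trans_eq ?_
  rw [← Set.image_comp]; rfl

theorem ediam_image_convexHull (f : (ι → ℝ) →ₗ[ℝ] ℝ) (S : Set (ι → ℝ)) :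
    Metric.ediam (f '' convexHull ℝ S) = Metric.ediam (f '' S) := by
  rw [f.image_convexHull, convexHull_ediam]

theorem ofReal_sub_le_ediam_image {α : Type*} (f : (ι → ℝ) →ₗ[ℝ] ℝ) (p : α → ι → ℝ) (i j : α) :
    ENNReal.ofReal (f (p i) - f (p j)) ≤ Metric.ediam (f '' convexHull ℝ (Set.range p)) := by
  rw [ediam_image_convexHull]
  refine le_trans ?_ (Metric.edist_le_ediam_of_mem (x := f (p i)) (y := f (p j))
    ⟨_, ⟨i, rfl⟩, rfl⟩ ⟨_, ⟨j, rfl⟩, rfl⟩)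
  rw [edist_dist, Real.dist_eq]
  exact ENNReal.ofReal_le_ofReal (le_abs_self _)

theorem exists_lt_sub_of_lt_ediam_image {α : Type*} (f : (ι → ℝ) →ₗ[ℝ] ℝ) (p : α → ι → ℝ)
    {W : ℝ} (h : ENNReal.ofReal W < Metric.ediam (f '' convexHull ℝ (Set.range p))) :
    ∃ i j, W < f (p i) - f (p j) := by
  rw [ediam_image_convexHull] at h
  by_contra! hW
  refine h.not_ge (Metric.ediam_le ?_)
  rintro _ ⟨_, ⟨i, rfl⟩, rfl⟩ _ ⟨_, ⟨j, rfl⟩, rfl⟩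
  rw [edist_dist, Real.dist_eq]
  refine ENNReal.ofReal_le_ofReal (abs_le'.2 ⟨hW i j, ?_⟩)
  rw [neg_sub]; exact hW j i

theorem vectorSpan_convexHull_eq (S : Set (ι → ℝ)) :
    vectorSpan ℝ (convexHull ℝ S) = vectorSpan ℝ S := by
  rw [← direction_affineSpan, affineSpan_convexHull, direction_affineSpan]

end LatticeWidth

/-! ### Functions on a cycle -/

section Cyclic

variable {d : ℕ}

theorem Fin.ofNat_add_one_eq (n : ℕ) :
    Fin.ofNat (d + 1) (n + 1) = Fin.ofNat (d + 1) n + 1 := by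
  ext; simp [Fin.val_add, Fin.ofNat]

theorem cyclic_induction {P : Fin (d + 1) → Prop} (a : Fin (d + 1)) (h0 : P a)
    (h : ∀ i, P i → P (i + 1)) (i : Fin (d + 1)) : P i := by
  have key : ∀ n : ℕ, P (a + (Fin.ofNat (d + 1) n)) := by
    intro n
    induction n with
    | zero => simpa [Fin.ofNat] using h0
    | succ n ih =>
      rw [Fin.ofNat_add_one_eq, ← add_assoc]
      exact h _ ih
  have := key (i - a).val
  rwa [Fin.ofNat_val_eq_self, add_sub_cancel] at this

/-- On a cycle of odd length, steps of size two reach every place. -/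
theorem eq_of_forall_add_one_eq_sub_one {α : Type*} (hd : Even d) (f : Fin (d + 1) → α)
    (h : ∀ i, f (i + 1) = f (i - 1)) (i j : Fin (d + 1)) : f i = f j := by
  have h2 : ∀ i, f (i + 1 + 1) = f i := fun i => by rw [h, add_sub_cancel_right]
  have key : ∀ (n : ℕ) (i : Fin (d + 1)), f (i + n • (1 + 1)) = f i := by
    intro n
    induction n with
    | zero => simp
    | succ n ih =>
      intro i
      rw [succ_nsmul, ← add_assoc, ← add_assoc, h2, ih]
  obtain ⟨k, rfl⟩ := hd
  have h1 : ∀ i, f (i + 1) = f i := fun i => by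
    have h3 : (k + 1) • ((1 : Fin (k + k + 1)) + 1) = 1 := by
      have h4 : (k + k + 1) • (1 : Fin (k + k + 1)) = 0 := by
        have := card_nsmul_eq_zero' (x := (1 : Fin (k + k + 1)))
        rwa [Nat.card_fin] at this
      calc (k + 1) • ((1 : Fin (k + k + 1)) + 1) = (k + k + 1) • (1 : Fin (k + k + 1)) + 1 := by
            rw [nsmul_add, ← add_nsmul, ← succ_nsmul]; congr 1; ring
        _ = 1 := by rw [h4, zero_add]
    rw [← key (k + 1) i, h3]
  exact cyclic_induction (P := fun i => f i = f j) j rfl (fun i hi => (h1 i).trans hi) i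

theorem sum_mul_shift_sub_shift (f : Fin (d + 1) → ℝ) :
    ∑ i, f i * (f (i + 1) - f (i - 1)) = 0 := by
  have h := Equiv.sum_comp (Equiv.addRight (1 : Fin (d + 1))) fun i => f i * f (i - 1)
  simp only [Equiv.coe_addRight, add_sub_cancel_right] at h
  simp only [mul_sub, Finset.sum_sub_distrib, ← h]
  simp [mul_comm]

theorem sum_shift_sub_shift (f : Fin (d + 1) → ℝ) :
    ∑ i, (f (i + 1) - f (i - 1)) = 0 := by
  have h := Equiv.sum_comp (Equiv.addRight (1 : Fin (d + 1))) f
  have h' := Equiv.sum_comp (Equiv.subRight (1 : Fin (d + 1))) f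
  simp only [Equiv.coe_addRight, Equiv.subRight_apply] at h h'
  rw [Finset.sum_sub_distrib, h, h', sub_self]

/-- On a cycle of odd length, a non-constant function increases around some `i` and decreases
around some `j` with `f j ≤ f i`. -/
theorem exists_increase_decrease (hd : Even d) (f : Fin (d + 1) → ℤ) (hf : ∃ i j, f i ≠ f j) :
    ∃ i j, f (i - 1) < f (i + 1) ∧ f (j + 1) < f (j - 1) ∧ f j ≤ f i := by
  by_contra! hcon
  obtain ⟨a, b, hab⟩ := hf
  refine hab (eq_of_forall_add_one_eq_sub_one hd f ?_ a b)
  -- If the claim fails, an integer `t` separates the values at ascents from those at descents. Then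
  -- all terms `(t - 1/2 - f i) (f (i+1) - f (i-1))` are nonnegative, but their sum telescopes to
  -- zero. The first factor is never zero, so the second always is.
  obtain ⟨t, ht1, ht2⟩ : ∃ t : ℤ, (∀ i, f (i - 1) < f (i + 1) → f i < t) ∧
      ∀ j, f (j + 1) < f (j - 1) → t ≤ f j := by
    by_cases hne : (Finset.univ.filter fun j => f (j + 1) < f (j - 1)).Nonempty
    · obtain ⟨j, hj, hmin⟩ := Finset.exists_min_image _ f hne
      simp only [Finset.mem_filter, Finset.mem_univ, true_and] at hj hmin
      exact ⟨f j, fun i hi => hcon i j hi hj, hmin⟩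
    · obtain ⟨i, -, hmax⟩ := Finset.exists_max_image Finset.univ f Finset.univ_nonempty
      refine ⟨f i + 1, fun j _ => by have := hmax j (Finset.mem_univ _); omega, fun j hj => ?_⟩
      exact absurd ⟨j, by simpa using hj⟩ hne
  have hsum : ∑ i, ((t : ℝ) - 1 / 2 - f i) * ((f (i + 1) : ℝ) - f (i - 1)) = 0 := by
    simp only [sub_mul _ (f _ : ℝ), Finset.sum_sub_distrib, ← Finset.mul_sum]
    rw [← Finset.sum_sub_distrib, sum_shift_sub_shift fun i => (f i : ℝ),
      sum_mul_shift_sub_shift fun i => (f i : ℝ)]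
    simp
  have hnn : ∀ i, 0 ≤ ((t : ℝ) - 1 / 2 - f i) * ((f (i + 1) : ℝ) - f (i - 1)) := by
    intro i
    rcases lt_trichotomy (f (i - 1)) (f (i + 1)) with h | h | h
    · have h1 : (f i : ℝ) + 1 ≤ t := by exact_mod_cast ht1 i h
      have h2 : (f (i - 1) : ℝ) < f (i + 1) := by exact_mod_cast h
      apply mul_nonneg <;> linarith
    · simp [h]
    · have h1 : (t : ℝ) ≤ f i := by exact_mod_cast ht2 i h
      have h2 : (f (i + 1) : ℝ) < f (i - 1) := by exact_mod_cast h
      apply mul_nonneg_of_nonpos_of_nonpos <;> linarith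
  intro i
  have h0 := (Finset.sum_eq_zero_iff_of_nonneg fun i _ => hnn i).1 hsum i (Finset.mem_univ _)
  rcases mul_eq_zero.1 h0 with h | h
  · exfalso
    have h1 : (2 : ℝ) * t - 1 = 2 * f i := by linarith
    have h2 : 2 * t - 1 = 2 * f i := by exact_mod_cast h1
    omega
  · exact_mod_cast sub_eq_zero.1 h

end Cyclic

/-! ### Width and emptiness of the circulant simplices -/

section Circulant

variable {d : ℕ}

theorem circulantVertex_apply (m : ℝ) (i j : Fin (d + 1)) :
    circulantVertex d m i j = (if i = j then 1 else 0) + (if i = j - 1 then m else 0) -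
      (if i = j + 1 then m else 0) := by
  have h1 : j - i = 0 ↔ i = j := by rw [sub_eq_zero, eq_comm]
  have h2 : j - i = 1 ↔ i = j - 1 := by
    rw [sub_eq_iff_eq_add, eq_sub_iff_add_eq, add_comm 1 i, eq_comm]
  have h3 : j - i = Fin.last d ↔ i = j + 1 := by
    rw [← add_left_inj (1 : Fin (d + 1)), Fin.last_add_one, sub_add_eq_add_sub, sub_eq_zero,
      eq_comm]
  simp only [circulantVertex, circulantGenerator, Pi.add_apply, Pi.sub_apply, Pi.single_apply,
    h1, h2, h3]

theorem sum_smul_circulantVertex (m : ℝ) (w : Fin (d + 1) → ℝ) (j : Fin (d + 1)) :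
    (∑ i, w i • circulantVertex d m i) j = w j + m * (w (j - 1) - w (j + 1)) := by
  simp [circulantVertex_apply, Finset.sum_apply, mul_add, mul_sub, Finset.sum_add_distrib,
    mul_comm, add_sub_assoc]

theorem sum_apply_sum_smul_circulantVertex (m : ℝ) (w : Fin (d + 1) → ℝ) :
    ∑ j, (∑ i, w i • circulantVertex d m i) j = ∑ i, w i := by
  simp only [sum_smul_circulantVertex, Finset.sum_add_distrib, ← Finset.mul_sum]
  have h := sum_shift_sub_shift w
  have : ∑ j, (w (j - 1) - w (j + 1)) = 0 := by
    rw [← neg_eq_zero, ← Finset.sum_neg_distrib, ← h]; simp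
  rw [this]; simp

theorem sum_circulantVertex (m : ℝ) (i : Fin (d + 1)) : ∑ j, circulantVertex d m i j = 1 := by
  have h := sum_apply_sum_smul_circulantVertex m (Pi.single i (1 : ℝ))
  simpa only [Pi.single_apply, ite_smul, one_smul, zero_smul, Finset.sum_ite_eq', Finset.mem_univ,
    if_true] using h

/-- The matrix is the identity plus a skew-symmetric one: pairing a relation with its own
coefficients `w` leaves `∑ w j ^ 2 = 0`. -/
theorem linearIndependent_circulantVertex (d : ℕ) (m : ℝ) :
    LinearIndependent ℝ (circulantVertex d m) := by
  rw [Fintype.linearIndependent_iff]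
  intro w hw i
  have h1 : ∑ j, w j * w j = 0 := by
    have h2 : ∀ j, w j * w j = m * (w j * (w (j + 1) - w (j - 1))) := fun j => by
      have := congrFun hw j
      rw [sum_smul_circulantVertex, Pi.zero_apply] at this
      linear_combination w j * this
    rw [Finset.sum_congr rfl fun j _ => h2 j, ← Finset.mul_sum, sum_mul_shift_sub_shift, mul_zero]
  have := (Finset.sum_eq_zero_iff_of_nonneg fun j _ => mul_self_nonneg (w j)).1 h1 i
    (Finset.mem_univ _)
  simpa using this

theorem isLatticePoint_circulantVertex (m : ℕ) (i : Fin (d + 1)) :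
    IsLatticePoint (circulantVertex d m i) := fun j =>
  ⟨(if i = j then 1 else 0) + (if i = j - 1 then m else 0) - (if i = j + 1 then m else 0), by
    rw [circulantVertex_apply]; push_cast; rfl⟩

theorem isLatticeSimplex_circulantVertex (d m : ℕ) :
    IsLatticeSimplex (circulantVertex d m) :=
  ⟨(linearIndependent_circulantVertex d m).affineIndependent, isLatticePoint_circulantVertex m⟩

theorem mem_vectorSpan_circulantSimplex (m : ℝ) (x : Fin (d + 1) → ℝ) :
    x ∈ vectorSpan ℝ (circulantSimplex d m) ↔ ∑ i, x i = 0 := by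
  set s : (Fin (d + 1) → ℝ) →ₗ[ℝ] ℝ := ∑ i, LinearMap.proj i with hs
  have hs' : ∀ y, s y = ∑ i, y i := fun y => by simp [hs]
  have hle : vectorSpan ℝ (Set.range (circulantVertex d m)) ≤ LinearMap.ker s := by
    rw [vectorSpan_def, Submodule.span_le]
    rintro _ ⟨_, ⟨i, rfl⟩, _, ⟨j, rfl⟩, rfl⟩
    simp [hs', Finset.sum_sub_distrib, sum_circulantVertex]
  have hker : Module.finrank ℝ (LinearMap.ker s) = d := by
    have h1 := s.finrank_range_add_finrank_ker
    have h2 : LinearMap.range s = ⊤ := by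
      rw [LinearMap.range_eq_top]
      exact fun c => ⟨Pi.single 0 c, by simp [hs']⟩
    rw [h2] at h1
    simp at h1
    omega
  have hfin := (linearIndependent_circulantVertex d m).affineIndependent.finrank_vectorSpan
    (Fintype.card_fin _)
  have heq := Submodule.eq_of_le_of_finrank_eq hle (hfin.trans hker.symm)
  rw [circulantSimplex, vectorSpan_convexHull_eq, heq, LinearMap.mem_ker, hs']

theorem latticeWidth_circulantSimplex (hd : Even d) (hd2 : 2 ≤ d) {m : ℕ} (hm : 1 ≤ m) :
    latticeWidth (circulantSimplex d m) = ((2 * m : ℕ) : ENNReal) := by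
  have hm1 : (1 : ℝ) ≤ m := by exact_mod_cast hm
  apply le_antisymm
  · have hproj : IsLatticeFunctional (circulantSimplex d m) (LinearMap.proj 0) := by
      refine ⟨fun x _ hx => hx 0, Pi.single 0 1 - Pi.single 1 1, ?_, ?_⟩
      · rw [mem_vectorSpan_circulantSimplex]
        simp [Finset.sum_sub_distrib]
      · have : (0 : Fin (d + 1)) ≠ 1 := by
          rw [Ne, Fin.ext_iff]; simp [Nat.mod_eq_of_lt (show 1 < d + 1 by omega)]
        simp [this]
    · refine (iInf₂_le _ hproj).trans ?_
      rw [circulantSimplex, ediam_image_convexHull]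
      have hsub : (LinearMap.proj (R := ℝ) (φ := fun _ : Fin (d + 1) => ℝ) 0) ''
          Set.range (circulantVertex d m) ⊆ Set.Icc (-m : ℝ) m := by
        rintro _ ⟨_, ⟨i, rfl⟩, rfl⟩
        have e1 : (-1 : Fin (d + 1)) ≠ 0 := by
          rw [Ne, neg_eq_zero, Fin.ext_iff]
          simp [Nat.mod_eq_of_lt (show 1 < d + 1 by omega)]
        have e2 : (1 : Fin (d + 1)) ≠ 0 := by rw [← neg_ne_zero]; exact e1
        have e3 : (-1 : Fin (d + 1)) ≠ 1 := by
          rw [Ne, neg_eq_iff_add_eq_zero, Fin.ext_iff]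
          simp [Fin.val_add, Nat.mod_eq_of_lt (show 2 < d + 1 by omega)]
        simp only [LinearMap.proj_apply, circulantVertex_apply, zero_sub, zero_add, Set.mem_Icc]
        by_cases h0 : i = 0
        · subst h0; simp [e1.symm, e2.symm]; constructor <;> linarith
        by_cases h1 : i = -1
        · subst h1; simp [e1, e3]
        by_cases h2 : i = 1
        · subst h2; simp [e2, e3.symm]
        simp [h0, h1, h2]
      refine (Metric.ediam_mono hsub).trans ?_
      rw [Real.ediam_Icc, ← ENNReal.ofReal_natCast]
      apply ENNReal.ofReal_le_ofReal
      push_cast; linarith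
  · refine le_iInf₂ fun f hf => ?_
    -- Only vectors of coordinate sum zero are parallel to the simplex. So `f` is an integer
    -- functional `F` plus a real multiple of the coordinate sum, which is constant on the simplex.
    have hbasis : ∀ i, ∃ n : ℤ, f (Pi.single i 1 - Pi.single 0 1) = n := fun i => by
      refine hf.1 _ ((mem_vectorSpan_circulantSimplex _ _).2 (by simp [Finset.sum_sub_distrib]))
        fun j => ⟨(Pi.single i 1 - Pi.single 0 1 : Fin (d + 1) → ℤ) j, ?_⟩
      simp [Pi.single_apply]
    choose F hF using hbasis
    set c := f (Pi.single 0 1) with hc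
    have hf1 : ∀ i, f (Pi.single i 1) = F i + c := fun i => by
      rw [← hF, map_sub, sub_add_cancel]
    have hfx : ∀ x : Fin (d + 1) → ℝ, f x = ∑ i, x i * F i + c * ∑ i, x i := fun x => by
      conv_lhs => rw [← Finset.univ_sum_single x, map_sum]
      rw [Finset.mul_sum, ← Finset.sum_add_distrib]
      refine Finset.sum_congr rfl fun i _ => ?_
      rw [← mul_one (x i), ← smul_eq_mul, Pi.single_smul, map_smul, hf1, smul_eq_mul, smul_eq_mul]
      ring
    have hnc : ∃ i j, F i ≠ F j := by
      by_contra! h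
      obtain ⟨x, hx, hx0⟩ := hf.2
      rw [mem_vectorSpan_circulantSimplex] at hx
      apply hx0
      rw [hfx, hx, Finset.sum_congr rfl fun i _ => by rw [h i 0], ← Finset.sum_mul, hx]
      simp
    obtain ⟨i, j, h1, h2, h3⟩ := exists_increase_decrease hd F hnc
    refine le_trans ?_ (ofReal_sub_le_ediam_image f (circulantVertex d m) i j)
    have hv : ∀ i, f (circulantVertex d m i) = F i + m * (F (i + 1) - F (i - 1)) + c := fun i => by
      have e : ∀ j, circulantVertex d m i j = (if i = j then 1 else 0) +
          (if i + 1 = j then (m : ℝ) else 0) - (if i - 1 = j then (m : ℝ) else 0) := fun j => by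
        rw [circulantVertex_apply]; simp only [eq_sub_iff_add_eq, sub_eq_iff_eq_add]
      rw [hfx, sum_circulantVertex]
      simp only [e, add_mul, sub_mul, ite_mul, one_mul, zero_mul, Finset.sum_add_distrib,
        Finset.sum_sub_distrib, Finset.sum_ite_eq, Finset.mem_univ, if_true]
      ring
    rw [← ENNReal.ofReal_natCast]
    apply ENNReal.ofReal_le_ofReal
    rw [hv, hv]
    have h1' : (F (i - 1) : ℝ) + 1 ≤ F (i + 1) := by exact_mod_cast h1
    have h2' : (F (j + 1) : ℝ) + 1 ≤ F (j - 1) := by exact_mod_cast h2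
    have h3' : (F j : ℝ) ≤ F i := by exact_mod_cast h3
    push_cast
    nlinarith

/-- A nonnegative cyclic sequence of length `d + 1` that satisfies the Fibonacci inequality
at all but one places vanishes if the `d`-th Fibonacci polynomial is larger than one. -/
theorem eq_zero_of_fib_recurrence_le {x : ℝ} (hx : 0 < x) {d : ℕ} (hF : 1 < fibPoly x d)
    (s : ℕ → ℝ) (hs : ∀ t, 0 ≤ s t) (hrec : ∀ t < d, s t + x * s (t + 1) ≤ s (t + 2))
    (hper : s (d + 1) = s 0) (t : ℕ) (ht : t ≤ d + 1) : s t = 0 := by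
  have hgrow : ∀ t, t ≤ d → fibPoly x t * s 0 + fibPoly x (t + 1) * s 1 ≤ s (t + 1) := by
    intro t
    induction t using Nat.twoStepInduction with
    | zero => intro _; simp [fibPoly_zero, fibPoly_one]
    | one => intro h; simpa [fibPoly, add_comm] using hrec 0 h
    | more n h1 h2 =>
      intro h
      have h3 := hrec (n + 1) (by omega)
      have h4 := h1 (by omega)
      have h5 := mul_le_mul_of_nonneg_left (h2 (by omega)) hx.le
      rw [fibPoly_add_two x (n + 1), fibPoly_add_two x n]
      rw [fibPoly_add_two x n] at h5
      linarith
  -- After a full turn, `F_d(x) * s 0 ≤ s (d + 1) = s 0` with `F_d(x) > 1`. From `s (d + 1) = 0` the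
  -- inequality then forces the earlier terms to vanish, going backwards.
  have h0 : s 0 = 0 := by
    have h1 := hgrow d le_rfl
    have h2 := mul_nonneg (fibPoly_nonneg hx.le (d + 1)) (hs 1)
    have h3 := hs 0
    rw [hper] at h1
    by_contra hne
    have : 0 < s 0 := lt_of_le_of_ne h3 (Ne.symm hne)
    nlinarith
  have hdown : ∀ n, n ≤ d + 1 → s (d + 1 - n) = 0 := by
    intro n
    induction n with
    | zero => intro _; rw [Nat.sub_zero, hper, h0]
    | succ n ih =>
      intro hn
      rcases Nat.eq_zero_or_pos (d - n) with h | h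
      · rw [show d + 1 - (n + 1) = 0 by omega, h0]
      · obtain ⟨t, ht⟩ : ∃ t, d - n = t + 1 := ⟨d - n - 1, by omega⟩
        have h1 := hrec t (by omega)
        rw [show t + 2 = d + 1 - n by omega, ih (by omega)] at h1
        rw [show d + 1 - (n + 1) = t + 1 by omega]
        have h2 := hs t
        have h3 := hs (t + 1)
        by_contra hne
        have : 0 < x * s (t + 1) := mul_pos hx (lt_of_le_of_ne h3 (Ne.symm hne))
        linarith
  have := hdown (d + 1 - t) (by omega)
  rwa [show d + 1 - (d + 1 - t) = t by omega] at this

theorem isEmptyLatticeSimplex_circulantVertex {m : ℕ} (hm : 1 ≤ m)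
    (hF : 1 < fibPoly (m : ℝ)⁻¹ d) : IsEmptyLatticeSimplex (circulantVertex d m) := by
  refine ⟨isLatticeSimplex_circulantVertex d m, fun x hx hxl => ?_⟩
  obtain ⟨w, hw0, hw1, rfl⟩ := (mem_convexHull_range _ _).1 hx
  choose n hn using hxl
  simp only [sum_smul_circulantVertex] at hn
  have hm0 : (0 : ℝ) < m := by exact_mod_cast hm
  set τ : Fin (d + 1) → ℝ := fun j => Int.fract (m * w j) with hτ
  have hτ0 : ∀ j, 0 ≤ τ j := fun j => Int.fract_nonneg _
  have hτ1 : ∀ j, τ j < 1 := fun j => Int.fract_lt_one _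
  have hτw : ∀ j, (m : ℝ)⁻¹ * τ j ≤ w j := fun j => by
    rw [inv_mul_le_iff₀ hm0]
    have := Int.self_sub_floor (m * w j)
    have h2 : (0 : ℝ) ≤ ⌊m * w j⌋ := by
      exact_mod_cast Int.floor_nonneg.2 (mul_nonneg hm0.le (hw0 j))
    simp only [hτ]; linarith
  have hwle : ∀ j, w j ≤ 1 := fun j =>
    hw1 ▸ Finset.single_le_sum (fun i _ => hw0 i) (Finset.mem_univ j)
  -- The integral part of `w j`: since `w j ≥ 0` and differences of fractional parts are below 1, `c
  -- j > -1`. The differences cancel around the cycle, so the `c j` sum to 1 and exactly one of them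
  -- is nonzero.
  set c : Fin (d + 1) → ℤ := fun j => n j + ⌊m * w (j + 1)⌋ - ⌊m * w (j - 1)⌋ with hc
  have hwc : ∀ j, w j = c j + (τ (j + 1) - τ (j - 1)) := fun j => by
    simp only [hτ, hc, Int.fract]; push_cast; rw [← hn]; ring
  have hcnn : ∀ j, 0 ≤ c j := fun j => by
    have h1 : (-1 : ℝ) < c j := by linarith [hwc j, hτ0 (j - 1), hτ1 (j + 1), hw0 j]
    have h2 : (-1 : ℤ) < c j := by exact_mod_cast h1
    omega
  have hcsum : ∑ j, c j = 1 := by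
    have h : ∑ j, (c j : ℝ) = 1 := by
      rw [← hw1, Finset.sum_congr rfl fun j _ => hwc j, Finset.sum_add_distrib,
        sum_shift_sub_shift, add_zero]
    exact_mod_cast h
  obtain ⟨j₀, hj₀⟩ : ∃ j, c j ≠ 0 := by
    by_contra! h
    simp [h] at hcsum
  have hc0 : ∀ j, j ≠ j₀ → c j = 0 := fun j hj => by
    have h1 := Finset.add_sum_erase Finset.univ c (Finset.mem_univ j₀)
    have h2 := Finset.single_le_sum (f := c) (fun i _ => hcnn i)
      (Finset.mem_erase.2 ⟨hj, Finset.mem_univ j⟩)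
    have h3 := hcnn j
    have h4 := hcnn j₀
    omega
  -- Starting the walk at the exceptional place `j₀`, the inequalities are centred at `j₀ + 1, …, j₀
  -- + d` and avoid it.
  have hs := eq_zero_of_fib_recurrence_le (inv_pos.2 hm0) hF
    (fun t => τ (j₀ + Fin.ofNat (d + 1) t)) (fun t => hτ0 _) (fun t ht => ?_) ?_
  · have hτz : ∀ j, τ j = 0 := fun j => by
      have := hs (j - j₀).val (by omega)
      simpa only [Fin.ofNat_val_eq_self, add_sub_cancel] using this
    refine ⟨j₀, ?_⟩
    have hwz : ∀ j, j ≠ j₀ → w j = 0 := fun j hj => by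
      rw [hwc, hc0 j hj, hτz, hτz]; simp
    rw [Finset.sum_eq_single j₀ (fun j _ hj => hwz j hj) (by simp)] at hw1
    rw [Finset.sum_eq_single j₀ (fun j _ hj => by rw [hwz j hj, zero_smul]) (by simp), hw1,
      one_smul]
  · have h1 := hwc (j₀ + Fin.ofNat (d + 1) (t + 1))
    rw [hc0, Int.cast_zero, zero_add] at h1
    · have h2 := hτw (j₀ + Fin.ofNat (d + 1) (t + 1))
      have e1 : j₀ + Fin.ofNat (d + 1) (t + 1) + 1 = j₀ + Fin.ofNat (d + 1) (t + 2) := by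
        rw [Fin.ofNat_add_one_eq (t + 1), add_assoc]
      have e2 : j₀ + Fin.ofNat (d + 1) (t + 1) - 1 = j₀ + Fin.ofNat (d + 1) t := by
        rw [Fin.ofNat_add_one_eq t, ← add_assoc, add_sub_cancel_right]
      rw [e1, e2] at h1
      linarith
    · rw [Ne, add_eq_left, Fin.ext_iff]
      simp [Fin.ofNat, Nat.mod_eq_of_lt (show t + 1 < d + 1 by omega)]
  · have : Fin.ofNat (d + 1) (d + 1) = Fin.ofNat (d + 1) 0 := by ext; simp [Fin.ofNat]
    rw [this]

end Circulant

/-! ### Full-dimensional simplices and frames at the origin -/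

theorem linearMap_apply_eq_dotProduct {J : Type*} [Fintype J] [DecidableEq J]
    (f : (J → ℝ) →ₗ[ℝ] ℝ) (x : J → ℝ) : f x = x ⬝ᵥ fun j => f (Pi.single j 1) := by
  conv_lhs => rw [← Finset.univ_sum_single x, map_sum]
  refine Finset.sum_congr rfl fun j _ => ?_
  rw [← mul_one (x j), ← smul_eq_mul, Pi.single_smul, map_smul, smul_eq_mul, smul_eq_mul, mul_one]

theorem eq_single_of_sum_le_one {J : Type*} [Fintype J] [DecidableEq J] {w : J → ℝ}
    (hw0 : ∀ j, 0 ≤ w j) (hw1 : ∑ j, w j ≤ 1) {j : J} (hj : w j = 1) : w = Pi.single j 1 := by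
  ext i
  by_cases h : i = j
  · subst h; simp [hj]
  · have h1 := Finset.add_sum_erase Finset.univ w (Finset.mem_univ j)
    have h2 := Finset.single_le_sum (f := w) (fun i _ => hw0 i)
      (Finset.mem_erase.2 ⟨h, Finset.mem_univ i⟩)
    have h3 := hw0 i
    rw [Pi.single_eq_of_ne h]
    linarith

/-- Forgetting the last coordinate loses nothing: on the hyperplane of coordinate sum 1 it is
recovered from the others, integrally. -/
theorem latticeWidth_circulantSimplex_le_maxEmptyWidth {d m : ℕ}
    (h : IsEmptyLatticeSimplex (circulantVertex d m)) :
    latticeWidth (circulantSimplex d m) ≤ maxEmptyWidth d := by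
  set T : (Fin (d + 1) → ℝ) →ₗ[ℝ] (Fin d → ℝ) := LinearMap.funLeft ℝ ℝ Fin.castSucc with hT
  have hTapply : ∀ x i, T x i = x i.castSucc := fun x i => rfl
  have hTl : ∀ x, IsLatticePoint x → IsLatticePoint (T x) := fun x hx i => hx _
  have hwidth := latticeWidth_le_image T hTl (circulantSimplex d m)
  rw [circulantSimplex, T.image_convexHull, ← Set.range_comp] at hwidth
  refine hwidth.trans (le_iSup₂_of_le (T ∘ circulantVertex d m) ⟨⟨?_, fun i => hTl _
    (h.isLatticePoint i)⟩, ?_⟩ le_rfl)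
  · rw [affineIndependent_iff_of_fintype]
    intro w hw0 hw
    rw [Finset.weightedVSub_eq_linear_combination _ hw0] at hw
    refine Fintype.linearIndependent_iff.1 (linearIndependent_circulantVertex d m) w ?_
    have h1 : T (∑ i, w i • circulantVertex d m i) = 0 := by
      rw [← hw, map_sum]; simp
    have h2 := sum_apply_sum_smul_circulantVertex (d := d) m w
    rw [hw0] at h2
    generalize ∑ i, w i • circulantVertex d m i = x at h1 h2
    have h3 : ∀ i : Fin d, x i.castSucc = 0 := congrFun h1
    rw [Fin.sum_univ_castSucc] at h2
    simp only [h3, Finset.sum_const_zero, zero_add] at h2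
    ext j
    refine Fin.lastCases h2 h3 j
  · intro y hy hyl
    obtain ⟨w, hw0, hw1, rfl⟩ := (mem_convexHull_range _ _).1 hy
    have h1 : ∑ i, w i • (T ∘ circulantVertex d m) i = T (∑ i, w i • circulantVertex d m i) := by
      simp [map_sum]
    rw [h1] at hyl ⊢
    have h2 := sum_apply_sum_smul_circulantVertex (d := d) m w
    rw [hw1] at h2
    have hmem : ∑ i, w i • circulantVertex d m i ∈ convexHull ℝ (Set.range (circulantVertex d m)) :=
      (mem_convexHull_range _ _).2 ⟨w, hw0, hw1, rfl⟩
    generalize ∑ i, w i • circulantVertex d m i = x at hyl h2 hmem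
    obtain ⟨i, rfl⟩ := h.eq_vertex x hmem fun j => by
      refine Fin.lastCases ?_ (fun i => hyl i) j
      choose n hn using hyl
      rw [Fin.sum_univ_castSucc] at h2
      refine ⟨1 - ∑ i, n i, ?_⟩
      push_cast
      simp only [← hn, hTapply]
      linarith
    exact ⟨i, rfl⟩

/-- The vectors `v i`, together with the origin, are the vertices of an empty simplex in which
every non-zero integral functional has range at least `W`. -/
structure IsEmptyFrame {I : Type*} [Fintype I] [DecidableEq I] (v : I → I → ℝ) (W : ℝ) :
    Prop where
  isLatticePoint : ∀ i, IsLatticePoint (v i)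
  linearIndependent : LinearIndependent ℝ v
  eq_single : ∀ w : I → ℝ, (∀ i, 0 ≤ w i) → ∑ i, w i ≤ 1 → IsLatticePoint (∑ i, w i • v i) →
    w = 0 ∨ ∃ i, w = Pi.single i 1
  width : ∀ F : I → ℤ, F ≠ 0 → ∃ a b : Option I,
    W ≤ (a.elim 0 v) ⬝ᵥ (fun i => (F i : ℝ)) - (b.elim 0 v) ⬝ᵥ (fun i => (F i : ℝ))

theorem IsLatticePoint.add {ι : Type*} {x y : ι → ℝ} (hx : IsLatticePoint x)
    (hy : IsLatticePoint y) : IsLatticePoint (x + y) := fun i => by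
  obtain ⟨a, ha⟩ := hx i
  obtain ⟨b, hb⟩ := hy i
  exact ⟨a + b, by simp [ha, hb]⟩

theorem IsLatticePoint.sub {ι : Type*} {x y : ι → ℝ} (hx : IsLatticePoint x)
    (hy : IsLatticePoint y) : IsLatticePoint (x - y) := fun i => by
  obtain ⟨a, ha⟩ := hx i
  obtain ⟨b, hb⟩ := hy i
  exact ⟨a - b, by simp [ha, hb]⟩

theorem IsLatticePoint.int_smul {ι : Type*} {x : ι → ℝ} (hx : IsLatticePoint x) (n : ℤ) :
    IsLatticePoint ((n : ℝ) • x) := fun i => by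
  obtain ⟨a, ha⟩ := hx i
  exact ⟨n * a, by simp [ha]⟩

theorem isLatticePoint_single {ι : Type*} [DecidableEq ι] (i : ι) :
    IsLatticePoint (Pi.single i (1 : ℝ)) := fun j => ⟨(Pi.single i 1 : ι → ℤ) j, by
  simp [Pi.single_apply]⟩

/-- Translate `p 0` to the origin; its barycentric coordinate is the slack in `∑ w i ≤ 1`. -/
theorem IsEmptyLatticeSimplex.isEmptyFrame {d : ℕ} {p : Fin (d + 1) → Fin d → ℝ}
    (hp : IsEmptyLatticeSimplex p) {W : ℝ}
    (hW : ENNReal.ofReal W < latticeWidth (convexHull ℝ (Set.range p))) :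
    IsEmptyFrame (fun i : Fin d => p i.succ - p 0) W := by
  have hind := hp.affineIndependent
  rw [affineIndependent_iff_of_fintype] at hind
  refine ⟨fun i => (hp.isLatticePoint _).sub (hp.isLatticePoint _), ?_, fun w hw0 hw1 hwl => ?_,
    fun F hF => ?_⟩
  · rw [Fintype.linearIndependent_iff]
    intro w hw i
    have h1 : ∑ j, (Fin.cons (-∑ j, w j) w : Fin (d + 1) → ℝ) j = 0 := by
      simp [Fin.sum_univ_succ]
    have h2 := hind _ h1 (by
      rw [Finset.weightedVSub_eq_linear_combination _ h1, ← hw]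
      simp [Fin.sum_univ_succ, smul_sub, Finset.sum_sub_distrib, Finset.sum_smul]
      abel) i.succ
    simpa using h2
  · have h1 : ∑ j, (Fin.cons (1 - ∑ j, w j) w : Fin (d + 1) → ℝ) j = 1 := by
      simp [Fin.sum_univ_succ]
    have h2 : ∑ j, (Fin.cons (1 - ∑ j, w j) w : Fin (d + 1) → ℝ) j • p j =
        p 0 + ∑ i, w i • (p i.succ - p 0) := by
      simp [Fin.sum_univ_succ, smul_sub, Finset.sum_sub_distrib, Finset.sum_smul, sub_smul]
      abel
    obtain ⟨j, hj⟩ := hp.eq_vertex (p 0 + ∑ i, w i • (p i.succ - p 0))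
      ((mem_convexHull_range _ _).2 ⟨_, fun j => by
        refine Fin.cases ?_ (fun i => ?_) j
        · simpa using hw1
        · simpa using hw0 i, h1, h2⟩)
      ((hp.isLatticePoint 0).add hwl)
    rw [← h2] at hj
    have h3 : ∑ i, (Fin.cons (1 - ∑ j, w j) w - Pi.single j 1 : Fin (d + 1) → ℝ) i = 0 := by
      simp only [Pi.sub_apply, Finset.sum_sub_distrib, h1]; simp
    have h4 := hind _ h3 (by
      rw [Finset.weightedVSub_eq_linear_combination _ h3]
      simp only [Pi.sub_apply, sub_smul, Finset.sum_sub_distrib, hj]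
      simp [Pi.single_apply, ite_smul])
    have h5 : ∀ i : Fin d, w i = (Pi.single j 1 : Fin (d + 1) → ℝ) i.succ := fun i => by
      have := h4 i.succ
      simp only [Pi.sub_apply, Fin.cons_succ] at this
      linarith
    rcases Fin.eq_zero_or_eq_succ j with rfl | ⟨i, rfl⟩
    · left; ext i; rw [h5]; simp
    · right; refine ⟨i, ?_⟩; ext i'; rw [h5]; simp [Pi.single_apply]
  · set f : (Fin d → ℝ) →ₗ[ℝ] ℝ := ∑ i, (F i : ℝ) • LinearMap.proj i with hf
    have hfx : ∀ x, f x = x ⬝ᵥ fun i => (F i : ℝ) := fun x => by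
      simp [hf, dotProduct, mul_comm]
    have htop : vectorSpan ℝ (convexHull ℝ (Set.range p)) = ⊤ := by
      rw [vectorSpan_convexHull_eq]
      exact hp.affineIndependent.vectorSpan_eq_top_of_card_eq_finrank_add_one (by simp)
    have hfl : IsLatticeFunctional (convexHull ℝ (Set.range p)) f := by
      constructor
      · intro x _ hx
        choose n hn using hx
        exact ⟨∑ i, n i * F i, by rw [hfx]; simp [dotProduct, hn]⟩
      · obtain ⟨i, hi⟩ := Function.ne_iff.1 hF
        refine ⟨Pi.single i 1, htop ▸ Submodule.mem_top, ?_⟩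
        rw [hfx]
        simpa using hi
    obtain ⟨i, j, hij⟩ := exists_lt_sub_of_lt_ediam_image f p (hW.trans_le (iInf₂_le f hfl))
    have hv : ∀ i, ∃ a : Option (Fin d),
        a.elim 0 (fun i : Fin d => p i.succ - p 0) = p i - p 0 := fun i => by
      rcases Fin.eq_zero_or_eq_succ i with rfl | ⟨i, rfl⟩
      exacts [⟨none, by simp⟩, ⟨some i, rfl⟩]
    obtain ⟨a, ha⟩ := hv i
    obtain ⟨b, hb⟩ := hv j
    refine ⟨a, b, ?_⟩
    rw [ha, hb, ← hfx, ← hfx, map_sub, map_sub]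
    linarith

theorem IsEmptyFrame.le_maxEmptyWidth {J : Type*} [Fintype J] [DecidableEq J] {u : J → J → ℝ}
    {W : ℝ} (hu : IsEmptyFrame u W) {D : ℕ} (hD : Fintype.card J = D) :
    ENNReal.ofReal W ≤ maxEmptyWidth D := by
  obtain ⟨e⟩ : Nonempty (J ≃ Fin D) := ⟨Fintype.equivFinOfCardEq hD⟩
  set T : (J → ℝ) ≃ₗ[ℝ] (Fin D → ℝ) := LinearEquiv.funCongrLeft ℝ ℝ e.symm with hT
  have hTapply : ∀ x i, T x i = x (e.symm i) := fun x i => rfl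
  have hTl : ∀ x, IsLatticePoint (T x) ↔ IsLatticePoint x := fun x =>
    ⟨fun h j => by simpa [hTapply] using h (e j), fun h i => h _⟩
  set p : Fin (D + 1) → Fin D → ℝ := Fin.cons 0 fun i => T (u (e.symm i)) with hp
  have hsum : ∀ w : Fin (D + 1) → ℝ, ∑ i, w i • p i = T (∑ j, w (e j).succ • u j) := fun w => by
    rw [Fin.sum_univ_succ, map_sum, ← Equiv.sum_comp e]
    simp [hp]
  have haff : AffineIndependent ℝ p := by
    rw [affineIndependent_iff_of_fintype]
    intro w hw0 hw
    rw [Finset.weightedVSub_eq_linear_combination _ hw0, hsum, LinearEquiv.map_eq_zero_iff] at hw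
    have h1 : ∀ i : Fin D, w i.succ = 0 := fun i => by
      simpa using Fintype.linearIndependent_iff.1 hu.linearIndependent _ hw (e.symm i)
    rw [Fin.sum_univ_succ] at hw0
    simp only [h1, Finset.sum_const_zero, add_zero] at hw0
    exact fun i => Fin.cases hw0 h1 i
  have hemp : IsEmptyLatticeSimplex p := by
    refine ⟨⟨haff, fun i => ?_⟩, fun x hx hxl => ?_⟩
    · refine Fin.cases (fun j => ⟨0, by simp [hp]⟩) (fun i => ?_) i
      simp only [hp, Fin.cons_succ]
      exact (hTl _).2 (hu.isLatticePoint _)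
    · obtain ⟨w, hw0, hw1, rfl⟩ := (mem_convexHull_range _ _).1 hx
      rw [hsum, hTl] at hxl
      rw [hsum]
      rw [Fin.sum_univ_succ, ← Equiv.sum_comp e] at hw1
      rcases hu.eq_single (fun j => w (e j).succ) (fun j => hw0 _) (by linarith [hw0 0]) hxl with
        h | ⟨j, h⟩
      · refine ⟨0, ?_⟩
        simp [congrFun h, hp]
      · refine ⟨(e j).succ, ?_⟩
        have h' : ∀ i, w (e i).succ = (Pi.single j 1 : J → ℝ) i := congrFun h
        simp [h', hp, Pi.single_apply, ite_smul]
  refine le_iSup₂_of_le p hemp (le_iInf₂ fun f hf => ?_)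
  have htop : vectorSpan ℝ (convexHull ℝ (Set.range p)) = ⊤ := by
    rw [vectorSpan_convexHull_eq]
    exact haff.vectorSpan_eq_top_of_card_eq_finrank_add_one (by simp)
  have hint : ∀ j, ∃ n : ℤ, f (T (Pi.single j 1)) = n := fun j =>
    hf.1 _ (htop ▸ Submodule.mem_top) ((hTl _).2 (isLatticePoint_single j))
  choose F hF using hint
  have hfx : ∀ x, f (T x) = x ⬝ᵥ fun j => (F j : ℝ) := fun x => by
    simp only [← hF]
    exact linearMap_apply_eq_dotProduct (f ∘ₗ T.toLinearMap) x
  have hF0 : F ≠ 0 := by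
    rintro rfl
    obtain ⟨y, -, hy⟩ := hf.2
    apply hy
    rw [← T.apply_symm_apply y, hfx]
    simp [dotProduct]
  obtain ⟨a, b, hab⟩ := hu.width F hF0
  have hv : ∀ a : Option J, ∃ i, p i = T (a.elim 0 u) := fun a => by
    rcases a with _ | j
    exacts [⟨0, by simp [hp]⟩, ⟨(e j).succ, by simp [hp]⟩]
  obtain ⟨i, hi⟩ := hv a
  obtain ⟨j, hj⟩ := hv b
  refine (ENNReal.ofReal_le_ofReal ?_).trans (ofReal_sub_le_ediam_image f p i j)
  rwa [hi, hj, hfx, hfx]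

/-! ### Large empty simplices from cyclically coupled copies of a small one -/

section CyclicBlocks

set_option linter.unusedSectionVars false

variable {I R : Type*} [Fintype I] [DecidableEq I] [Fintype R] [DecidableEq R] {n : ℕ}

/-- The vertices of a simplex that is made of `n + 1` copies of the simplex with vertices `0`, `v i`,
each dilated by `k` and perturbed by the preceding copy in cyclic order, together with `K`-fold unit
vectors for the elements of `R`, which are perturbed by distinct vertices of the first copy. -/
def cyclicBlocks (n : ℕ) (v : I → I → ℝ) (k K : ℝ) (φ : R → I) :
    (Fin (n + 1) × I) ⊕ R → (Fin (n + 1) × I) ⊕ R → ℝ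
  | .inl (c, i), .inl (c', a) => (if c = c' then k * v i a else 0) + if c = c' + 1 then v i a else 0
  | .inl _, .inr _ => 0
  | .inr s, .inl (c', a) => if c' = 0 then v (φ s) a else 0
  | .inr s, .inr s' => if s = s' then K else 0

/-- The coefficients with which the undilated vertices occur in the block `c` of a linear
combination of the vertices `cyclicBlocks`. -/
def blockPerturbation (φ : R → I) (w : (Fin (n + 1) × I) ⊕ R → ℝ) (c : Fin (n + 1)) (i : I) : ℝ :=
  w (.inl (c + 1, i)) + if c = 0 then ∑ s, if φ s = i then w (.inr s) else 0 else 0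

variable {v : I → I → ℝ} {k K W : ℝ} {φ : R → I} {w : (Fin (n + 1) × I) ⊕ R → ℝ}

theorem sum_smul_cyclicBlocks_inr (s : R) :
    (∑ j, w j • cyclicBlocks n v k K φ j) (.inr s) = K * w (.inr s) := by
  simp [Finset.sum_apply, cyclicBlocks, mul_comm]

theorem sum_smul_cyclicBlocks_inl (c : Fin (n + 1)) (a : I) :
    (∑ j, w j • cyclicBlocks n v k K φ j) (.inl (c, a)) =
      (∑ i, (k * w (.inl (c, i)) + blockPerturbation φ w c i) • v i) a := by
  have h1 : ∀ s, (if c = 0 then v (φ s) a else 0) =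
      ∑ i, if φ s = i then (if c = 0 then v i a else 0) else 0 := fun s => by simp
  simp only [Finset.sum_apply, Pi.smul_apply, smul_eq_mul, Fintype.sum_sum_type,
    Fintype.sum_prod_type, cyclicBlocks, blockPerturbation, h1]
  rw [Finset.sum_comm]
  simp only [Finset.mul_sum]
  rw [Finset.sum_comm (s := (Finset.univ : Finset R)), ← Finset.sum_add_distrib]
  refine Finset.sum_congr rfl fun i _ => ?_
  have h2 : ∑ s, w (.inr s) * (if φ s = i then (if c = 0 then v i a else 0) else 0) =
      (if c = 0 then ∑ s, if φ s = i then w (.inr s) else 0 else 0) * v i a := by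
    split_ifs with hc
    · rw [Finset.sum_mul]
      refine Finset.sum_congr rfl fun s _ => ?_
      split_ifs <;> simp
    · simp
  rw [h2]
  simp only [mul_add, mul_ite, mul_zero, Finset.sum_add_distrib, Finset.sum_ite_eq',
    Finset.mem_univ, if_true]
  ring

/-- In a relation, the weights of consecutive blocks differ by the factor `-k`; a largest one in
absolute value must vanish because `k > 1`. -/
theorem linearIndependent_cyclicBlocks (hv : LinearIndependent ℝ v) (hk : 1 < k) (hK : 0 < K) :
    LinearIndependent ℝ (cyclicBlocks n v k K φ) := by
  rw [Fintype.linearIndependent_iff]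
  intro w hw
  have hr : ∀ s, w (.inr s) = 0 := fun s => by
    have h := congrFun hw (.inr s)
    rw [sum_smul_cyclicBlocks_inr] at h
    exact (mul_eq_zero.1 h).resolve_left hK.ne'
  have hl : ∀ c i, k * w (.inl (c, i)) + w (.inl (c + 1, i)) = 0 := fun c i => by
    have h : ∑ i, (k * w (.inl (c, i)) + blockPerturbation φ w c i) • v i = 0 := by
      ext a
      rw [← sum_smul_cyclicBlocks_inl (K := K) (k := k) (w := w), hw]; rfl
    have h1 := Fintype.linearIndependent_iff.1 hv _ h i
    simpa [blockPerturbation, hr] using h1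
  rintro (⟨c₀, i₀⟩ | s)
  · have : Nonempty I := ⟨i₀⟩
    obtain ⟨⟨c, i⟩, hmax⟩ := Finite.exists_max fun x : Fin (n + 1) × I => |w (.inl x)|
    have h1 := hmax (c + 1, i)
    have h2 := hmax (c₀, i₀)
    have h3 : w (.inl (c + 1, i)) = -(k * w (.inl (c, i))) := by linarith [hl c i]
    rw [h3, abs_neg, abs_mul, abs_of_pos (by linarith : 0 < k)] at h1
    have h4 := abs_nonneg (w (.inl (c, i)))
    have h5 : |w (.inl (c, i))| ≤ 0 := by nlinarith
    exact abs_eq_zero.1 (le_antisymm (h2.trans h5) (abs_nonneg _))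
  · exact hr s

theorem isLatticePoint_cyclicBlocks (hv : ∀ i, IsLatticePoint (v i)) (k K : ℤ)
    (j : (Fin (n + 1) × I) ⊕ R) : IsLatticePoint (cyclicBlocks n v k K φ j) := by
  choose z hz using hv
  rcases j with ⟨c, i⟩ | s
  · rintro (⟨c', a⟩ | s')
    · exact ⟨(if c = c' then k * z i a else 0) + if c = c' + 1 then z i a else 0, by
        simp only [cyclicBlocks, hz]; push_cast; rfl⟩
    · exact ⟨0, by simp [cyclicBlocks]⟩
  · rintro (⟨c', a⟩ | s')
    · exact ⟨if c' = 0 then z (φ s) a else 0, by simp only [cyclicBlocks, hz]; push_cast; rfl⟩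
    · exact ⟨if s = s' then K else 0, by simp only [cyclicBlocks]; push_cast; rfl⟩

theorem blockPerturbation_nonneg (hw : ∀ j, 0 ≤ w j) (c : Fin (n + 1)) (i : I) :
    0 ≤ blockPerturbation φ w c i := by
  refine add_nonneg (hw _) ?_
  split_ifs
  · exact Finset.sum_nonneg fun s _ => by split_ifs <;> simp [hw]
  · exact le_rfl

theorem sum_sum_blockPerturbation :
    ∑ c, ∑ i, blockPerturbation φ w c i = ∑ j, w j := by
  have h := Equiv.sum_comp (Equiv.addRight (1 : Fin (n + 1))) fun c => ∑ i, w (.inl (c, i))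
  simp only [Equiv.coe_addRight] at h
  rw [Fintype.sum_sum_type, Fintype.sum_prod_type, ← h]
  simp only [blockPerturbation, Finset.sum_add_distrib]
  congr 1
  rw [Finset.sum_comm]
  simp only [Finset.sum_ite_eq', Finset.mem_univ, if_true]
  rw [Finset.sum_comm]
  simp

/-- If block `c` has no weights of its own, its perturbation is a lattice point of the small
simplex, hence zero or a unit vector. A unit vector forces some `w j = 1`, unless `c = 0` and it is
shared between `(1, φ s)` and `s`. The choice `K = k M + 1`, prime to `k`, excludes such a split. -/
theorem IsEmptyFrame.blockPerturbation_eq_zero (hv : IsEmptyFrame v W) (hφ : Function.Injective φ)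
    (hn : 2 ≤ n) {k M : ℤ} (hw0 : ∀ j, 0 ≤ w j) (hw1 : ∑ j, w j ≤ 1)
    (hwl : IsLatticePoint (∑ j, w j • cyclicBlocks n v k (k * M + 1 : ℤ) φ j))
    (hne : ∀ j, w j ≠ 1) (c : Fin (n + 1)) (hc : ∀ i, w (.inl (c, i)) = 0) :
    ∀ i, blockPerturbation φ w c i = 0 := by
  have hblock : ∀ c, IsLatticePoint
      (∑ i, (k * w (.inl (c, i)) + blockPerturbation φ w c i) • v i) := fun c a => by
    rw [← sum_smul_cyclicBlocks_inl (K := ((k * M + 1 : ℤ) : ℝ))]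
    exact hwl _
  have hsum : ∑ i, blockPerturbation φ w c i ≤ 1 := by
    refine le_trans ?_ hw1
    rw [← sum_sum_blockPerturbation (φ := φ)]
    exact Finset.single_le_sum (f := fun c => ∑ i, blockPerturbation φ w c i)
      (fun c _ => Finset.sum_nonneg fun i _ => blockPerturbation_nonneg hw0 c i) (Finset.mem_univ c)
  have hlat := hblock c
  simp only [hc, mul_zero, zero_add] at hlat
  rcases hv.eq_single _ (blockPerturbation_nonneg hw0 c) hsum hlat with h | ⟨i, h⟩
  · exact congrFun h
  exfalso
  have hi : blockPerturbation φ w c i = 1 := by rw [h]; simp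
  by_cases hc0 : c = 0
  swap
  · rw [blockPerturbation, if_neg hc0, add_zero] at hi
    exact hne _ hi
  subst hc0
  rw [blockPerturbation, if_pos rfl] at hi
  by_cases hs : ∃ s, φ s = i
  swap
  · push Not at hs
    simp only [hs, if_false, Finset.sum_const_zero, add_zero] at hi
    exact hne _ hi
  obtain ⟨s, rfl⟩ := hs
  simp only [hφ.eq_iff, Finset.sum_ite_eq', Finset.mem_univ, if_true, zero_add] at hi
  set l := w (.inl (1, φ s)) with hl
  have hrest : ∀ j, j ≠ .inl (1, φ s) → j ≠ .inr s → w j = 0 := fun j h1 h2 => by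
    have e1 := Finset.add_sum_erase Finset.univ w (Finset.mem_univ (.inl (1, φ s)))
    have e2 := Finset.add_sum_erase (Finset.univ.erase (.inl (1, φ s))) w
      (Finset.mem_erase.2 ⟨by simp, Finset.mem_univ (.inr s)⟩)
    have e3 := Finset.single_le_sum (f := w) (fun i _ => hw0 i)
      (Finset.mem_erase.2 ⟨h2, Finset.mem_erase.2 ⟨h1, Finset.mem_univ j⟩⟩)
    have e4 := hw0 j
    linarith
  have h10 : (1 : Fin (n + 1)) ≠ 0 := by
    rw [Ne, Fin.ext_iff]; simp; omega
  have hkl : IsLatticePoint ((k * l) • v (φ s)) := by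
    have h1 := hblock 1
    have h2 : ∀ i, blockPerturbation φ w (1 : Fin (n + 1)) i = 0 := fun i => by
      rw [blockPerturbation, if_neg h10, add_zero]
      exact hrest _ (by simp [h10]) (by simp)
    simp only [h2, add_zero] at h1
    rwa [Finset.sum_eq_single (φ s) (fun i _ hi => by rw [hrest _ (by simp [hi]) (by simp)]; simp)
      (by simp)] at h1
  obtain ⟨z, hz⟩ := hwl (.inr s)
  rw [sum_smul_cyclicBlocks_inr] at hz
  -- From `K (1 - l) = z` follows `l = (k M + 1 - z) - M (k l)`, and `k l • v (φ s)` is the lattice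
  -- point in block 1. So `l` is 0 or 1.
  have hll : IsLatticePoint (l • v (φ s)) := by
    have h1 := ((hv.isLatticePoint (φ s)).int_smul (k * M + 1 - z)).sub (hkl.int_smul M)
    convert h1 using 1
    rw [smul_smul, ← sub_smul]
    congr 1
    push_cast at hz ⊢
    linear_combination -hz + (k * M + 1) * hi
  have h1 := hv.eq_single (Pi.single (φ s) l) (fun i => by
    rw [Pi.single_apply]; split_ifs
    exacts [hw0 _, le_rfl]) (by simp; linarith [hw0 (.inr s)])
    (by simpa [Pi.single_apply, ite_smul] using hll)
  rcases h1 with h1 | ⟨i, h1⟩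
  · have : l = 0 := by simpa using congrFun h1 (φ s)
    exact hne (.inr s) (by linarith)
  · have h2 := congrFun h1 i
    rw [Pi.single_eq_same, Pi.single_apply] at h2
    split_ifs at h2
    · exact hne _ h2
    · exact zero_ne_one h2

theorem IsEmptyFrame.cyclicBlocks_eq_single (hv : IsEmptyFrame v W) (hφ : Function.Injective φ)
    {k M : ℕ} (hk : 2 ≤ k) (hkn : k + 1 ≤ n) (hw0 : ∀ j, 0 ≤ w j) (hw1 : ∑ j, w j ≤ 1)
    (hwl : IsLatticePoint
      (∑ j, w j • cyclicBlocks n v (k : ℤ) ((k : ℤ) * (M : ℤ) + 1 : ℤ) φ j)) :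
    w = 0 ∨ ∃ j, w = Pi.single j 1 := by
  by_cases hne : ∃ j, w j = 1
  · obtain ⟨j, hj⟩ := hne
    exact Or.inr ⟨j, eq_single_of_sum_le_one hw0 hw1 hj⟩
  push Not at hne
  left
  have hz := hv.blockPerturbation_eq_zero hφ (by omega) hw0 hw1 hwl hne
  have hnn : ∀ c i, 0 ≤ k * w (.inl (c, i)) + blockPerturbation φ w c i := fun c i =>
    add_nonneg (mul_nonneg (Nat.cast_nonneg _) (hw0 _)) (blockPerturbation_nonneg hw0 c i)
  -- The coefficients of all blocks sum to at most `k + 1 ≤ n`, and there are `n + 1` blocks. A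
  -- block of total below 1 carries only the lattice point 0, and its vanishing spreads from each
  -- block to the next.
  obtain ⟨c₀, hc₀⟩ : ∃ c, ∑ i, (k * w (.inl (c, i)) + blockPerturbation φ w c i) < 1 := by
    by_contra! h
    have h1 := Finset.sum_le_sum fun c (_ : c ∈ Finset.univ) => h c
    simp only [Finset.sum_add_distrib, sum_sum_blockPerturbation, ← Finset.mul_sum] at h1
    have h2 : ∑ c, ∑ i, w (.inl (c, i)) ≤ ∑ j, w j := by
      rw [Fintype.sum_sum_type, Fintype.sum_prod_type]
      have : 0 ≤ ∑ s, w (.inr s) := Finset.sum_nonneg fun s _ => hw0 _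
      linarith
    simp only [Finset.sum_const, Finset.card_univ, Fintype.card_fin, nsmul_eq_mul, mul_one] at h1
    have h3 : ((k + 1 : ℕ) : ℝ) ≤ n := by exact_mod_cast hkn
    push_cast at h1 h3
    have h4 : (k : ℝ) * ∑ c, ∑ i, w (.inl (c, i)) ≤ k * 1 := by
      gcongr
      exact h2.trans hw1
    linarith
  have hstart : ∀ i, w (.inl (c₀, i)) = 0 := by
    have hlat : IsLatticePoint
        (∑ i, (k * w (.inl (c₀, i)) + blockPerturbation φ w c₀ i) • v i) := fun a => by
      have h := hwl (.inl (c₀, a))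
      rwa [sum_smul_cyclicBlocks_inl, Int.cast_natCast] at h
    rcases hv.eq_single _ (hnn c₀) hc₀.le hlat with h | ⟨i, h⟩
    · intro i
      have h1 := congrFun h i
      have h2 := blockPerturbation_nonneg (φ := φ) hw0 c₀ i
      have h3 := hw0 (.inl (c₀, i))
      have h4 : (2 : ℝ) ≤ k := by exact_mod_cast hk
      simp only [Pi.zero_apply] at h1
      nlinarith
    · rw [Finset.sum_congr rfl fun i _ => congrFun h i] at hc₀
      simp at hc₀
  have hsplit : ∀ c i, blockPerturbation φ w c i = 0 → w (.inl (c + 1, i)) = 0 ∧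
      (c = 0 → ∑ s, (if φ s = i then w (.inr s) else 0) = 0) := fun c i h => by
    have h1 : 0 ≤ ∑ s, (if φ s = i then w (.inr s) else 0) :=
      Finset.sum_nonneg fun s _ => by split_ifs <;> simp [hw0]
    have h2 := hw0 (.inl (c + 1, i))
    rw [blockPerturbation] at h
    split_ifs at h with hc
    · exact ⟨by linarith, fun _ => by linarith⟩
    · exact ⟨by linarith, fun h => absurd h hc⟩
  have hall : ∀ c i, w (.inl (c, i)) = 0 := fun c =>
    cyclic_induction (P := fun c => ∀ i, w (.inl (c, i)) = 0) c₀ hstart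
      (fun c hc i => (hsplit c i (hz c hc i)).1) c
  ext (⟨c, i⟩ | s)
  · exact hall c i
  · have h1 := (hsplit 0 (φ s) (hz 0 (hall 0) _)).2 rfl
    have h2 := (Finset.sum_eq_zero_iff_of_nonneg fun s _ => by
      split_ifs <;> simp [hw0]).1 h1 s (Finset.mem_univ s)
    simpa using h2

theorem cyclicBlocks_inl_dotProduct (F : (Fin (n + 1) × I) ⊕ R → ℝ) (c : Fin (n + 1)) (i : I) :
    cyclicBlocks n v k K φ (.inl (c, i)) ⬝ᵥ F =
      k * (v i ⬝ᵥ fun a => F (.inl (c, a))) + v i ⬝ᵥ fun a => F (.inl (c - 1, a)) := by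
  have h : ∀ c', c = c' + 1 ↔ c - 1 = c' := fun c' => sub_eq_iff_eq_add.symm
  simp only [dotProduct, Fintype.sum_sum_type, Fintype.sum_prod_type, cyclicBlocks, h, zero_mul,
    Finset.sum_const_zero, add_zero, add_mul, Finset.sum_add_distrib, ite_mul]
  rw [Finset.sum_comm, Finset.sum_comm (f := fun c' a => if c - 1 = c' then _ else _)]
  simp only [Finset.sum_ite_eq, Finset.mem_univ, if_true, Finset.mul_sum, mul_assoc]

theorem cyclicBlocks_inr_dotProduct (F : (Fin (n + 1) × I) ⊕ R → ℝ) (s : R) :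
    cyclicBlocks n v k K φ (.inr s) ⬝ᵥ F =
      (v (φ s) ⬝ᵥ fun a => F (.inl (0, a))) + K * F (.inr s) := by
  simp only [dotProduct, Fintype.sum_sum_type, Fintype.sum_prod_type, cyclicBlocks, ite_mul,
    zero_mul, Finset.sum_ite_eq, Finset.mem_univ, if_true]
  rw [Finset.sum_comm]
  simp

/-- Take the block and the two small vertices with the largest difference `δ ≥ W`. The dilated copy
contributes `k δ`, and the perturbation, another difference of the same kind, takes away at most
`δ`. A functional that vanishes on all blocks is seen by the vertices of `R`, where `K` is large. -/
theorem IsEmptyFrame.cyclicBlocks_width (hv : IsEmptyFrame v W) (hk : 1 ≤ k)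
    (hK : (k - 1) * W ≤ K) (hK0 : 0 ≤ K) (F : (Fin (n + 1) × I) ⊕ R → ℤ) (hF : F ≠ 0) :
    ∃ a b : Option ((Fin (n + 1) × I) ⊕ R), (k - 1) * W ≤
      (a.elim 0 (cyclicBlocks n v k K φ)) ⬝ᵥ (fun i => (F i : ℝ)) -
        (b.elim 0 (cyclicBlocks n v k K φ)) ⬝ᵥ (fun i => (F i : ℝ)) := by
  by_cases hl : ∀ c i, F (.inl (c, i)) = 0
  · obtain ⟨s, hs⟩ : ∃ s, F (.inr s) ≠ 0 := by
      by_contra! h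
      exact hF (funext fun j => by rcases j with ⟨c, i⟩ | s; exacts [hl c i, h s])
    have hval : cyclicBlocks n v k K φ (.inr s) ⬝ᵥ (fun i => (F i : ℝ)) = K * F (.inr s) := by
      rw [cyclicBlocks_inr_dotProduct]; simp [hl, dotProduct]
    rcases lt_or_gt_of_ne hs with h | h
    · refine ⟨none, some (.inr s), ?_⟩
      have h1 : (F (.inr s) : ℝ) ≤ -1 := by exact_mod_cast (by omega : F (.inr s) ≤ -1)
      simp only [Option.elim, hval, zero_dotProduct]
      nlinarith
    · refine ⟨some (.inr s), none, ?_⟩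
      have h1 : (1 : ℝ) ≤ F (.inr s) := by exact_mod_cast h
      simp only [Option.elim, hval, zero_dotProduct]
      nlinarith
  · push Not at hl
    obtain ⟨c₁, i₁, h₁⟩ := hl
    set z : Fin (n + 1) → Option I → ℝ := fun c a =>
      (a.elim 0 v) ⬝ᵥ fun i => (F (.inl (c, i)) : ℝ) with hz
    obtain ⟨⟨c, a, b⟩, hmax⟩ := Finite.exists_max
      fun x : Fin (n + 1) × Option I × Option I => z x.1 x.2.1 - z x.1 x.2.2
    have hW : W ≤ z c a - z c b := by
      obtain ⟨a', b', h⟩ := hv.width (fun i => F (.inl (c₁, i))) (Function.ne_iff.2 ⟨i₁, h₁⟩)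
      exact h.trans (hmax (c₁, a', b'))
    have hval : ∀ a : Option I, ∃ a' : Option ((Fin (n + 1) × I) ⊕ R),
        (a'.elim 0 (cyclicBlocks n v k K φ)) ⬝ᵥ (fun i => (F i : ℝ)) =
          k * z c a + z (c - 1) a := fun a => by
      rcases a with _ | i
      · exact ⟨none, by simp [hz]⟩
      · exact ⟨some (.inl (c, i)), cyclicBlocks_inl_dotProduct _ c i⟩
    obtain ⟨a', ha'⟩ := hval a
    obtain ⟨b', hb'⟩ := hval b
    refine ⟨a', b', ?_⟩
    rw [ha', hb']
    have h1 := hmax (c - 1, b, a)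
    simp only at h1
    nlinarith

theorem IsEmptyFrame.cyclicBlocks (hv : IsEmptyFrame v W) (hφ : Function.Injective φ)
    {k M : ℕ} (hk : 2 ≤ k) (hkn : k + 1 ≤ n) (hM : W ≤ M) :
    IsEmptyFrame (cyclicBlocks n v (k : ℤ) ((k : ℤ) * (M : ℤ) + 1 : ℤ) φ) ((k - 1) * W) where
  isLatticePoint := isLatticePoint_cyclicBlocks hv.isLatticePoint _ _
  linearIndependent := linearIndependent_cyclicBlocks hv.linearIndependent
    (by exact_mod_cast (by omega : 1 < k)) (by positivity)
  eq_single _ hw0 hw1 hwl := hv.cyclicBlocks_eq_single hφ hk hkn hw0 hw1 hwl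
  width F hF := by
    have hk' : (2 : ℝ) ≤ k := by exact_mod_cast hk
    have hM0 : (0 : ℝ) ≤ M := Nat.cast_nonneg M
    refine hv.cyclicBlocks_width (by simp; linarith) ?_ (by positivity) F hF
    push_cast
    nlinarith

end CyclicBlocks

/-! ### Existence of the limit and its lower bound -/

theorem ofReal_mul_le_maxEmptyWidth {d : ℕ} {W : ℝ} (hW : ENNReal.ofReal W < maxEmptyWidth d)
    {n k r : ℕ} (hk : 2 ≤ k) (hkn : k + 1 ≤ n) (hr : r ≤ d) :
    ENNReal.ofReal ((k - 1) * W) ≤ maxEmptyWidth ((n + 1) * d + r) := by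
  simp only [maxEmptyWidth, lt_iSup_iff] at hW
  obtain ⟨p, hp, hpW⟩ := hW
  exact ((hp.isEmptyFrame hpW).cyclicBlocks (R := Fin r) (Fin.castLE_injective hr) hk hkn
    (Nat.le_ceil W)).le_maxEmptyWidth (by simp)

theorem ofReal_sub_mul_le_maxEmptyWidth {d : ℕ} (hd : 1 ≤ d) {W : ℝ} (hW0 : 0 ≤ W)
    (hW : ENNReal.ofReal W < maxEmptyWidth d) {D : ℕ} (hD : 4 * d ≤ D) :
    ENNReal.ofReal (((D : ℝ) / d - 4) * W) ≤ maxEmptyWidth D := by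
  have hN : 4 ≤ D / d := (Nat.le_div_iff_mul_le hd).2 hD
  obtain ⟨N, hN'⟩ : ∃ N, D / d = N + 4 := ⟨D / d - 4, by omega⟩
  -- There are `N + 4 = ⌊D/d⌋` blocks, and the remainder `D % d` is the size of `R`. The factor `k -
  -- 1 = ⌊D/d⌋ - 3` exceeds `D/d - 4`.
  have h := ofReal_mul_le_maxEmptyWidth hW (n := N + 3) (k := N + 2) (by omega) (by omega)
    (Nat.mod_lt D hd).le
  rw [show N + 3 + 1 = D / d by omega, Nat.div_add_mod'] at h
  refine (ENNReal.ofReal_le_ofReal ?_).trans h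
  refine mul_le_mul_of_nonneg_right ?_ hW0
  have h1 : (D : ℝ) / d < (D / d : ℕ) + 1 := by
    rw [← Nat.floor_div_eq_div (K := ℝ)]
    exact Nat.lt_floor_add_one _
  rw [hN'] at h1
  push_cast at h1 ⊢
  linarith

theorem maxEmptyWidth_div_le_liminf {d : ℕ} (hd : 1 ≤ d) :
    maxEmptyWidth d / d ≤ liminf (fun D : ℕ => maxEmptyWidth D / (D : ENNReal)) atTop := by
  have hd0 : (0 : ℝ) < d := by exact_mod_cast hd
  refine le_of_forall_lt_imp_le_of_dense fun c hc => ?_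
  have hctop : c ≠ ⊤ := hc.ne_top
  set W : ℝ := c.toReal * d with hWdef
  have hW0 : 0 ≤ W := by positivity
  have hW : ENNReal.ofReal W < maxEmptyWidth d := by
    rw [hWdef, ENNReal.ofReal_mul ENNReal.toReal_nonneg, ENNReal.ofReal_toReal hctop,
      ENNReal.ofReal_natCast]
    exact (ENNReal.lt_div_iff_mul_lt (Or.inl (by exact_mod_cast hd0.ne'))
      (Or.inl (ENNReal.natCast_ne_top d))).1 hc
  -- As `W = c d`, this quotient equals `c - 4 W / D`.
  have hlim : Tendsto (fun D : ℕ => ENNReal.ofReal ((((D : ℝ) / d - 4) * W) / D)) atTop (𝓝 c) := by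
    have h1 : Tendsto (fun D : ℕ => c.toReal - 4 * W / (D : ℝ)) atTop (𝓝 (c.toReal - 0)) :=
      tendsto_const_nhds.sub (tendsto_const_div_atTop_nhds_zero_nat _)
    rw [sub_zero] at h1
    have h2 := ENNReal.tendsto_ofReal h1
    rw [ENNReal.ofReal_toReal hctop] at h2
    refine h2.congr' ?_
    filter_upwards [eventually_ge_atTop 1] with D hD
    have hD0 : (D : ℝ) ≠ 0 := by positivity
    congr 1
    rw [hWdef]
    field_simp
  rw [← hlim.liminf_eq]
  refine liminf_le_liminf ?_
  filter_upwards [eventually_ge_atTop (4 * d)] with D hD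
  have hD0 : (0 : ℝ) < D := by exact_mod_cast (by omega : 0 < D)
  rw [ENNReal.ofReal_div_of_pos hD0, ENNReal.ofReal_natCast]
  gcongr
  exact ofReal_sub_mul_le_maxEmptyWidth hd hW0 hW hD

theorem tendsto_maxEmptyWidth_div :
    Tendsto (fun d : ℕ => maxEmptyWidth d / (d : ENNReal)) atTop
      (𝓝 (liminf (fun D : ℕ => maxEmptyWidth D / (D : ENNReal)) atTop)) := by
  refine tendsto_of_le_liminf_of_limsup_le le_rfl (limsup_le_of_le (by isBoundedDefault) ?_)
  filter_upwards [eventually_ge_atTop 1] with d hd using maxEmptyWidth_div_le_liminf hd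

theorem isEmptyLatticeSimplex_floor_threshold {k : ℕ} (hk : 2 ≤ k) :
    IsEmptyLatticeSimplex (circulantVertex (2 * k) (⌊threshold (2 * k)⌋₊ : ℝ)) :=
  isEmptyLatticeSimplex_circulantVertex
    (Nat.floor_pos.2 (one_le_threshold (by omega))) (one_lt_fibPoly_floor_threshold hk)

theorem two_mul_floor_threshold_le_maxEmptyWidth {k : ℕ} (hk : 2 ≤ k) :
    ((2 * ⌊threshold (2 * k)⌋₊ : ℕ) : ENNReal) ≤ maxEmptyWidth (2 * k) := by
  rw [← latticeWidth_circulantSimplex (even_two_mul k) (by omega)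
    (Nat.floor_pos.2 (one_le_threshold (by omega)))]
  exact latticeWidth_circulantSimplex_le_maxEmptyWidth (isEmptyLatticeSimplex_floor_threshold hk)

theorem ofReal_one_div_arsinh_one_le {L : ENNReal}
    (hL : Tendsto (fun d : ℕ => maxEmptyWidth d / (d : ENNReal)) atTop (𝓝 L)) :
    ENNReal.ofReal (1 / Real.arsinh 1) ≤ L := by
  have heven : Tendsto (fun k : ℕ => 2 * k) atTop atTop :=
    tendsto_id.const_mul_atTop' (by norm_num)
  -- Rounding `m₀` down costs less than 2 in the width, that is, less than `1 / k` after division by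
  -- `2k`.
  have h1 : Tendsto (fun k : ℕ => 2 * threshold (2 * k) / ((2 * k : ℕ) : ℝ) - 1 / (k : ℝ)) atTop
      (𝓝 (1 / Real.arsinh 1 - 0)) :=
    tendsto_two_mul_threshold_div.sub (tendsto_const_div_atTop_nhds_zero_nat 1)
  rw [sub_zero] at h1
  refine le_of_tendsto_of_tendsto (ENNReal.tendsto_ofReal h1) (hL.comp heven) ?_
  filter_upwards [eventually_ge_atTop 2] with k hk
  have hk0 : (0 : ℝ) < ((2 * k : ℕ) : ℝ) := by exact_mod_cast (by omega : 0 < 2 * k)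
  have h2 : 2 * threshold (2 * k) / ((2 * k : ℕ) : ℝ) - 1 / (k : ℝ) ≤
      ((2 * ⌊threshold (2 * k)⌋₊ : ℕ) : ℝ) / ((2 * k : ℕ) : ℝ) := by
    have hk1 : (k : ℝ) ≠ 0 := by positivity
    have h3 : 2 * threshold (2 * k) / ((2 * k : ℕ) : ℝ) - 1 / (k : ℝ) =
        (2 * threshold (2 * k) - 2) / ((2 * k : ℕ) : ℝ) := by
      push_cast; field_simp
    rw [h3]
    gcongr
    have := Nat.lt_floor_add_one (threshold (2 * k))
    push_cast
    linarith
  refine (ENNReal.ofReal_le_ofReal h2).trans ?_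
  rw [ENNReal.ofReal_div_of_pos hk0, ENNReal.ofReal_natCast, ENNReal.ofReal_natCast]
  exact ENNReal.div_le_div_right (two_mul_floor_threshold_le_maxEmptyWidth hk) _

theorem theorem1p3 :
    -- `m₀(d)` is well defined
    (∀ d : ℕ, Even d → 2 ≤ d → ∃! m : ℝ, IsThreshold d m) ∧
    -- `S(d, ⌊m₀(d)⌋)` is a lattice `d`-simplex of width `2⌊m₀(d)⌋`
    (∀ d : ℕ, Even d → 2 ≤ d →
      IsLatticeSimplex (circulantVertex d (⌊threshold d⌋₊ : ℝ)) ∧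
      latticeWidth (circulantSimplex d (⌊threshold d⌋₊ : ℝ)) =
        ((2 * ⌊threshold d⌋₊ : ℕ) : ENNReal)) ∧
    -- and it is empty
    (∀ d : ℕ, Even d → 4 ≤ d →
      IsEmptyLatticeSimplex (circulantVertex d (⌊threshold d⌋₊ : ℝ))) ∧
    -- the limit of `2 m₀(d) / d` over even `d`
    Tendsto (fun k : ℕ => 2 * threshold (2 * k) / ((2 * k : ℕ) : ℝ)) atTop
      (𝓝 (1 / Real.arsinh 1)) ∧
    1 / Real.arsinh 1 = 1 / Real.log (1 + √2) ∧
    |1 / Real.arsinh 1 - 1.1346| < 0.00005 ∧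
    -- the limit of `w_e(d) / d`
    (∃ L : ENNReal, Tendsto (fun d : ℕ => maxEmptyWidth d / (d : ENNReal)) atTop (𝓝 L) ∧
      ENNReal.ofReal (1 / Real.arsinh 1) ≤ L) := by
  refine ⟨fun d hd hd2 => existsUnique_isThreshold hd hd2, fun d hd hd2 => ?_, fun d hd hd4 => ?_,
    tendsto_two_mul_threshold_div, by rw [arsinh_one], abs_one_div_arsinh_one_sub_lt,
    _, tendsto_maxEmptyWidth_div, ofReal_one_div_arsinh_one_le tendsto_maxEmptyWidth_div⟩
  · obtain ⟨k, rfl⟩ := hd.two_dvd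
    exact ⟨isLatticeSimplex_circulantVertex _ _, latticeWidth_circulantSimplex hd hd2
      (Nat.floor_pos.2 (one_le_threshold (by omega)))⟩
  · obtain ⟨k, rfl⟩ := hd.two_dvd
    exact isEmptyLatticeSimplex_floor_threshold (by omega)
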